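/- Let $T>0$ and let $X_2\subseteq X_1\subseteq X_0$ be reflexive complex Banach spaces, each continuously and densely embedded in the next. Write $\Delta_2=\{(t,s):0\le s\le t\le T\}$. A *control* is a continuous $\omega:\Delta_2\to[0,\infty)$ with $\omega(s,s)=0$ and $\omega(t,r)+\omega(r,s)\le\omega(t,s)$ for $0\le s\le r\le t\le T$. A family $(L_t)_{t\in[0,T]}$ of closed linear operators on $X_0$ is called *admissible* if 1. $X_1\subseteq D(L_t)$ and $X_2\subseteq D(L_t^2)$ for every $t\in[0,T]$; 2. (sectoriality, with constant one on a real half-line) there are $\vartheta>0$, $\lambda\in\mathbb R$, $\Lambda>0$ such that for every $t\in[0,T]$ and $i=0,1,2$: the resolvent set of $L_t$ contains the sector $\Sigma=\{\zeta\in\mathbb C:|\arg(\zeta-\lambda)|<\pi/2+\vartheta\}$ (with $\arg 0=0$), and $(\zeta-L_t)^{-1}$ maps $X_i$ into $X_i$ with $$|(\zeta-L_t)^{-1}|_{\mathcal L(X_i)}\le\Lambda(1+|\zeta|)^{-1}\quad(\zeta\in\Sigma),\qquad |(r-L_t)^{-1}|_{\mathcal L(X_i)}\le (r-\lambda)^{-1}\quad(r\in\mathbb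 R,\ r>\lambda);$$ 3. for $k=0,1$ there are a control $\omega$ and $\varrho\in(0,1]$ such that for all $(t,s)\in\Delta_2$ the operator $L_t-L_s$ maps $X_{k+1}$ into $X_k$ and $|L_t-L_s|_{\mathcal L(X_{k+1},X_k)}\le\omega(t,s)^{\varrho}$. A *quasipropagator* of $(L_t)$ is a map $S:\Delta_2\to\mathcal L(X_0)$ such that * $(t,s)\mapsto S_{t,s}x$ is continuous on $\Delta_2$ in $X_0$ for each $x\in X_0$; each $S_{t,s}$ maps $X_1$ into $X_1$; and for some constants $\lambda',\Lambda'>0$, $|S_{t,s}|_{\mathcal L(X_0)},|S_{t,s}|_{\mathcal L(X_1)}\le\Lambda' e^{\lambda'(t-s)}$ on $\Delta_2$; * $S_{t,t}=\mathrm{id}$ and $S_{t,s}=S_{t,u}S_{u,s}$ for $0\le s\le u\le t\le T$; * for some constant $C$, $|S_{t,s}-\mathrm{id}|_{\mathcal L(X_1,X_0)}\le C|t-s|$ for $s<t$; * for $(t,s)\in\Delta_2$ and $x\in X_1$, $\frac{d}{dt}S_{t,s}x=L_tS_{t,s}x$ and $\frac{d}{ds}S_{t,s}x=-S_{t,s}L_sx$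 in $X_0$ (one-sided derivatives at the end points of $[s,T]$, respectively $[0,t]$). **Theorem (Lie–Trotter product formula).** Let $(A_t)_{t\in[0,T]}$ and $(B_t)_{t\in[0,T]}$ be admissible. Assume that $A_t+B_t$, with domain $D(A_t)\cap D(B_t)$, is closable for every $t\in[0,T]$, and that the family of closures $(\overline{A_t+B_t})_{t\in[0,T]}$ is admissible. Then $(A_t)$, $(B_t)$ and $(\overline{A_t+B_t})$ have quasipropagators. Moreover, for any such quasipropagators $S^A$, $S^B$, $S^{A+B}$, every $(t,s)\in\Delta_2$, every sequence of partitions $\mathcal P^n=\{s=\tau^n_0<\tau^n_1<\dots<\tau^n_{k_n}=t\}$ of $[s,t]$ whose mesh tends to $0$, and every $x\in X_0$, $$S^{A+B}_{t,s}x=\lim_{n\to\infty}\ \mu_{\tau^n_{k_n},\tau^n_{k_n-1}}\cdots\mu_{\tau^n_2,\tau^n_1}\,\mu_{\tau^n_1,\tau^n_0}\,x\quad\text{in }X_0,\qquad \mu_{v,u}:=S^A_{v,u}S^B_{v,u}.$$ -/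

import Mathlib

open Set Filter Topology

noncomputable section

/-- A normed space is reflexive if its canonical embedding into the bidual is onto. -/
def IsReflexiveSpace (X : Type*) [NormedAddCommGroup X] [NormedSpace ℂ X] : Prop :=
  Function.Surjective (NormedSpace.inclusionInDoubleDual ℂ X)

/-- The simplex of pairs `(t, s)` with `0 ≤ s ≤ t ≤ T`. -/
def simplex2 (T : ℝ) : Set (ℝ × ℝ) := {p | 0 ≤ p.2 ∧ p.2 ≤ p.1 ∧ p.1 ≤ T}

/-- A control on `[0, T]`: a continuous nonnegative function on the simplex, zero on the diagonal
and superadditive. -/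
structure IsControl (T : ℝ) (ω : ℝ → ℝ → ℝ) : Prop where
  continuousOn : ContinuousOn (fun p : ℝ × ℝ => ω p.1 p.2) (simplex2 T)
  nonneg : ∀ s t, 0 ≤ s → s ≤ t → t ≤ T → 0 ≤ ω t s
  diag : ∀ s, 0 ≤ s → s ≤ T → ω s s = 0
  superadd : ∀ s r t, 0 ≤ s → s ≤ r → r ≤ t → t ≤ T → ω t r + ω r s ≤ ω t s

/-- The sector `{ζ : |arg (ζ - lam)| < π / 2 + θ}`; since `arg 0 = 0` it contains `[lam, ∞)`. -/
def sector (θ lam : ℝ) : Set ℂ := {ζ | |Complex.arg (ζ - (lam : ℂ))| < Real.pi / 2 + θ}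

/-- `F : V → E` takes its values in the subspace `W` of `E` (embedded by `k`), and
`‖F v‖_W ≤ c ‖v‖_V`. For linear `F` this says that `F` is in `L(V, W)` with norm at most `c`. -/
def MapsWithBound {V W E : Type*} [NormedAddCommGroup V] [NormedSpace ℂ V]
    [NormedAddCommGroup W] [NormedSpace ℂ W] [NormedAddCommGroup E] [NormedSpace ℂ E]
    (k : W →L[ℂ] E) (F : V → E) (c : ℝ) : Prop :=
  ∀ v, ∃ w, k w = F v ∧ ‖w‖ ≤ c * ‖v‖

section

variable {X₀ X₁ X₂ : Type*}
  [NormedAddCommGroup X₀] [NormedSpace ℂ X₀]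
  [NormedAddCommGroup X₁] [NormedSpace ℂ X₁]
  [NormedAddCommGroup X₂] [NormedSpace ℂ X₂]

/-- `R` is the bounded two-sided inverse `(ζ - L)⁻¹` of the unbounded operator `ζ - L`. -/
def IsResolventAt (L : X₀ →ₗ.[ℂ] X₀) (ζ : ℂ) (R : X₀ →L[ℂ] X₀) : Prop :=
  (∀ y, ∃ h : R y ∈ L.domain, ζ • R y - L ⟨R y, h⟩ = y) ∧
    ∀ x : L.domain, R (ζ • (x : X₀) - L x) = x

/-- `ζ` lies in the resolvent set of `L`, and `(ζ - L)⁻¹` acts on each of the three spaces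
`X₂ ⊆ X₁ ⊆ X₀` (embedded by `ι₂`, `ι₁`) with operator norm at most `c`. -/
def ResolventBound (ι₁ : X₁ →L[ℂ] X₀) (ι₂ : X₂ →L[ℂ] X₁) (L : X₀ →ₗ.[ℂ] X₀)
    (ζ : ℂ) (c : ℝ) : Prop :=
  ∃ R : X₀ →L[ℂ] X₀, IsResolventAt L ζ R ∧ ‖R‖ ≤ c ∧
    MapsWithBound ι₁ (fun x : X₁ => R (ι₁ x)) c ∧
    MapsWithBound (ι₁ ∘L ι₂) (fun x : X₂ => R (ι₁ (ι₂ x))) c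

/-- The assumption on a family `(L t)`, `t ∈ [0, T]`, of unbounded operators on `X₀`: they are
closed, `X₁ ⊆ D(L t)` and `X₂ ⊆ D((L t)²)`; they are sectorial on the three spaces, uniformly
in `t`, with the sharp resolvent constant one on a real half-line (so that the semigroups
satisfy `‖exp (r L_t)‖ ≤ exp (lam * r)` on the three spaces); and `L t - L s` is controlled in
`L(X₁, X₀)` and in `L(X₂, X₁)`. -/
structure IsAdmissibleFamily (T : ℝ) (ι₁ : X₁ →L[ℂ] X₀) (ι₂ : X₂ →L[ℂ] X₁)
    (L : ℝ → X₀ →ₗ.[ℂ] X₀) : Prop where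
  closed : ∀ t ∈ Icc 0 T, (L t).IsClosed
  dom₁ : ∀ t ∈ Icc 0 T, ∀ x : X₁, ι₁ x ∈ (L t).domain
  dom₂ : ∀ t (ht : t ∈ Icc 0 T), ∀ x : X₂,
    L t ⟨ι₁ (ι₂ x), dom₁ t ht (ι₂ x)⟩ ∈ (L t).domain
  sectorial : ∃ θ > 0, ∃ lam : ℝ, ∃ Λ > 0, ∀ t ∈ Icc 0 T,
    (∀ ζ ∈ sector θ lam, ResolventBound ι₁ ι₂ (L t) ζ (Λ * (1 + ‖ζ‖)⁻¹)) ∧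
    (∀ r : ℝ, lam < r → ResolventBound ι₁ ι₂ (L t) (r : ℂ) (r - lam)⁻¹)
  variation₀ : ∃ ω : ℝ → ℝ → ℝ, IsControl T ω ∧ ∃ ϱ ∈ Ioc (0 : ℝ) 1,
    ∀ s t (hs : s ∈ Icc 0 T) (ht : t ∈ Icc 0 T), s ≤ t → ∀ x : X₁,
      ‖L t ⟨ι₁ x, dom₁ t ht x⟩ - L s ⟨ι₁ x, dom₁ s hs x⟩‖ ≤ (ω t s) ^ ϱ * ‖x‖
  variation₁ : ∃ ω : ℝ → ℝ → ℝ, IsControl T ω ∧ ∃ ϱ ∈ Ioc (0 : ℝ) 1,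
    ∀ s t (hs : s ∈ Icc 0 T) (ht : t ∈ Icc 0 T), s ≤ t →
      MapsWithBound ι₁
        (fun x : X₂ => L t ⟨ι₁ (ι₂ x), dom₁ t ht (ι₂ x)⟩ - L s ⟨ι₁ (ι₂ x), dom₁ s hs (ι₂ x)⟩)
        ((ω t s) ^ ϱ)

/-- `S` (of which only the values `S t s` with `0 ≤ s ≤ t ≤ T` matter) is a quasipropagator of
the family `L` with respect to the pair `X₁ ⊆ X₀`. At the end points of the intervals the
derivatives are one-sided. -/
structure IsQuasipropagator (T : ℝ) (ι₁ : X₁ →L[ℂ] X₀) (L : ℝ → X₀ →ₗ.[ℂ] X₀)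
    (S : ℝ → ℝ → X₀ →L[ℂ] X₀) : Prop where
  continuousOn : ∀ x, ContinuousOn (fun p : ℝ × ℝ => S p.1 p.2 x) (simplex2 T)
  growth : ∃ lam > 0, ∃ Λ > 0, ∀ s t, 0 ≤ s → s ≤ t → t ≤ T →
    ‖S t s‖ ≤ Λ * Real.exp (lam * (t - s)) ∧
    MapsWithBound ι₁ (fun x : X₁ => S t s (ι₁ x)) (Λ * Real.exp (lam * (t - s)))
  diag : ∀ s, 0 ≤ s → s ≤ T → S s s = ContinuousLinearMap.id ℂ X₀
  mul : ∀ s u t, 0 ≤ s → s ≤ u → u ≤ t → t ≤ T → S t s = S t u ∘L S u s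
  lipschitz : ∃ C > 0, ∀ s t, 0 ≤ s → s < t → t ≤ T → ∀ x : X₁,
    ‖S t s (ι₁ x) - ι₁ x‖ ≤ C * (t - s) * ‖x‖
  deriv_left : ∀ s t, 0 ≤ s → s ≤ t → t ≤ T → ∀ x : X₁,
    ∃ h : S t s (ι₁ x) ∈ (L t).domain,
      HasDerivWithinAt (fun τ => S τ s (ι₁ x)) (L t ⟨S t s (ι₁ x), h⟩) (Icc s T) t
  deriv_right : ∀ s t, 0 ≤ s → s ≤ t → t ≤ T → ∀ x : X₁,
    ∃ h : ι₁ x ∈ (L s).domain,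
      HasDerivWithinAt (fun σ => S t σ (ι₁ x)) (-(S t s (L s ⟨ι₁ x, h⟩))) (Icc 0 t) s

end

/-- A partition `s = node 0 < node 1 < ... < node size = t` of `[s, t]`. -/
structure IntervalPartition (s t : ℝ) where
  size : ℕ
  node : ℕ → ℝ
  node_zero : node 0 = s
  node_size : node size = t
  node_lt : ∀ i < size, node i < node (i + 1)

/-- The mesh of a partition, the largest length of its intervals. -/
def IntervalPartition.mesh {s t : ℝ} (P : IntervalPartition s t) : ℝ :=
  ⨆ i : Fin P.size, (P.node ((i : ℕ) + 1) - P.node (i : ℕ))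

/-- The product `μ (τ n) (τ (n-1)) ∘ ... ∘ μ (τ 1) (τ 0)`, later times to the left. -/
def orderedProd {X : Type*} [NormedAddCommGroup X] [NormedSpace ℂ X]
    (μ : ℝ → ℝ → X →L[ℂ] X) (τ : ℕ → ℝ) : ℕ → X →L[ℂ] X
  | 0 => ContinuousLinearMap.id ℂ X
  | n + 1 => μ (τ (n + 1)) (τ n) ∘L orderedProd μ τ n

end

/-!
The propagators are built by backward Euler, and the product formula is then a matter of stability
and consistency.

*Existence.* The resolvent bound with constant one on the real half-line says that the steps
`J_{h,t} = (1 - h L_t)⁻¹` have norm at most `exp (c h)` on each of the three spaces, so all products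
of steps are bounded on `X₀`, `X₁` and `X₂`, uniformly in the step size. On `X₂`, which lies in the
domain of `L_t²`, one step of size `h` and `N` steps of size `h / N` with time frozen at `r` both
equal `1 + h L_r + O(h²)`, and freezing the time costs at most
`h * sup ‖L_u - L_r‖_{L(X₁, X₀)}`. The constant in `O(h²)` is not uniform in `r`, but a finite net
of times `r` suffices (`EulerScheme.exists_norm_approx_sub_le`). Hence the Euler approximations
converge strongly (`EulerScheme.exists_isPropagator`); reflexivity is what lets the limit inherit
the bounds on `X₁` and `X₂` (`IsReflexiveSpace.exists_of_tendsto`).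

*Differentiability.* Trajectories starting in `X₁` are continuous in the graph norm of each `L_r`,
because on `X₂` the operator `L_r` is controlled by `L_r²` and the norm of `X₀`
(`EulerScheme.exists_norm_gen_le`). Along curves `z` with this continuity
`S_{v,u} z_u - z_u = (v - u) L_r z_r + o(v - u)` as `u ≤ v` tend to `r`
(`EulerScheme.IsPropagator.exists_norm_sub_le`). This contains both evolution equations, and by
the latter quasipropagators are unique (`IsQuasipropagator.eq`).

*Product formula.* Uniqueness reduces the claim to the propagators constructed here, whose growth
bound on `X₀` has constant one, so products of `S^A S^B` stay bounded. Applying the expansion above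
to `S^A`, `S^B` and `S^{A+B}` along one trajectory `z_u = S^{A+B}_{u,s} x`, with `x` in `X₁`, gives a
local error `o(v - u)`, locally uniformly in time. Summing the local errors gives convergence for
`x` in `X₁`, hence for all `x` by density.
-/

noncomputable section

/-! ### Functional analytic preliminaries -/

/-- The image of a ball of a reflexive space under a bounded operator is closed under limits of
sequences: by Banach-Alaoglu the ball is weakly compact, and a weak limit is mapped to the limit. -/
theorem IsReflexiveSpace.exists_of_tendsto {X E : Type*} [NormedAddCommGroup X] [NormedSpace ℂ X]
    [NormedAddCommGroup E] [NormedSpace ℂ E] (hX : IsReflexiveSpace X) (k : X →L[ℂ] E)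
    {w : ℕ → X} {y : E} {r : ℝ} (hw : ∀ᶠ n in atTop, ‖w n‖ ≤ r)
    (h : Tendsto (fun n => k (w n)) atTop (𝓝 y)) : ∃ x, k x = y ∧ ‖x‖ ≤ r := by
  have hc := WeakDual.isCompact_closedBall (𝕜 := ℂ)
    (0 : StrongDual ℂ (StrongDual ℂ X)) r
  let 𝒰 : Ultrafilter ℕ := Ultrafilter.of atTop
  have hU : (𝒰 : Filter ℕ) ≤ atTop := Ultrafilter.of_le _
  let j : ℕ → WeakDual ℂ (StrongDual ℂ X) :=
    fun n => StrongDual.toWeakDual (NormedSpace.inclusionInDoubleDual ℂ X (w n))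
  obtain ⟨Φ, hΦ, hlim⟩ := hc.ultrafilter_le_nhds (𝒰.map j) (by
    rw [Ultrafilter.coe_map, le_principal_iff, Filter.mem_map]
    filter_upwards [hU hw] with n hn
    have := (NormedSpace.double_dual_bound ℂ X (w n)).trans hn
    simpa [j] using this)
  obtain ⟨x, hx⟩ := hX (WeakDual.toStrongDual Φ)
  have hΦr : ‖WeakDual.toStrongDual Φ‖ ≤ r := by simpa using hΦ
  refine ⟨x, ?_, ?_⟩
  · rw [SeparatingDual.eq_iff_forall_dual_eq (R := ℂ)]
    intro g
    have h1 : Tendsto (fun n => g (k (w n))) 𝒰 (𝓝 (g y)) :=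
      ((g.continuous.tendsto y).comp h).mono_left hU
    have h2 : Tendsto (fun n => (j n) (g ∘L k)) 𝒰 (𝓝 (Φ (g ∘L k))) :=
      ((WeakDual.eval_continuous (𝕜 := ℂ) (g ∘L k)).tendsto Φ).comp hlim
    have h3 : Φ (g ∘L k) = g (k x) := by
      change (WeakDual.toStrongDual Φ) (g ∘L k) = _
      rw [← hx]; rfl
    rw [h3] at h2
    exact tendsto_nhds_unique h2 h1
  · have h1 := (NormedSpace.inclusionInDoubleDualLi (E := X) ℂ).norm_map x
    rw [← h1]
    change ‖NormedSpace.inclusionInDoubleDual ℂ X x‖ ≤ r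
    rw [hx]; exact hΦr

/-- Closed graph theorem: a closed operator composed with a bounded operator into its domain is
bounded. -/
theorem LinearPMap.IsClosed.exists_comp_eq {X E : Type*} [NormedAddCommGroup X] [NormedSpace ℂ X]
    [CompleteSpace X] [NormedAddCommGroup E] [NormedSpace ℂ E] [CompleteSpace E]
    {L : E →ₗ.[ℂ] E} (hL : L.IsClosed) (F : X →L[ℂ] E) (hF : ∀ x, F x ∈ L.domain) :
    ∃ G : X →L[ℂ] E, ∀ x, G x = L ⟨F x, hF x⟩ := by
  let g : X →ₗ[ℂ] E := L.toFun ∘ₗ (F : X →ₗ[ℂ] E).codRestrict L.domain hF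
  refine ⟨⟨g, LinearMap.continuous_of_seq_closed_graph (g := g) ?_⟩, fun x => rfl⟩
  intro u x y hu hgu
  have h1 : Tendsto (fun n => (F (u n), g (u n))) atTop (𝓝 (F x, y)) :=
    ((F.continuous.tendsto x).comp hu).prodMk_nhds hgu
  have h2 : (F x, y) ∈ (L.graph : Set (E × E)) :=
    hL.mem_of_tendsto h1 (Eventually.of_forall fun n => L.mem_graph ⟨F (u n), hF (u n)⟩)
  obtain ⟨z, hz1, hz2⟩ := (LinearPMap.mem_graph_iff L).1 h2
  have : z = ⟨F x, hF x⟩ := Subtype.ext hz1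
  subst this
  exact hz2.symm

/-- An operator leaving a continuously embedded subspace invariant restricts to it. -/
theorem MapsWithBound.exists_clm {V W E : Type*} [NormedAddCommGroup V] [NormedSpace ℂ V]
    [NormedAddCommGroup W] [NormedSpace ℂ W] [NormedAddCommGroup E] [NormedSpace ℂ E]
    {k : W →L[ℂ] E} (hk : Function.Injective k) {F : V →L[ℂ] E} {c : ℝ}
    (hF : MapsWithBound k (fun v => F v) c) (hc : 0 ≤ c) :
    ∃ G : V →L[ℂ] W, (∀ v, k (G v) = F v) ∧ ‖G‖ ≤ c := by
  choose g hg hgc using hF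
  let G : V →ₗ[ℂ] W :=
    { toFun := g
      map_add' := fun x y => hk (by simp only [map_add, hg])
      map_smul' := fun a x => hk (by simp only [map_smul, hg, RingHom.id_apply]) }
  exact ⟨G.mkContinuous c hgc, hg, G.mkContinuous_norm_le hc hgc⟩

theorem MapsWithBound.mono {V W E : Type*} [NormedAddCommGroup V] [NormedSpace ℂ V]
    [NormedAddCommGroup W] [NormedSpace ℂ W] [NormedAddCommGroup E] [NormedSpace ℂ E]
    {k : W →L[ℂ] E} {F : V → E} {c c' : ℝ} (hF : MapsWithBound k F c) (h : c ≤ c') :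
    MapsWithBound k F c' := fun v => by
  obtain ⟨w, hw, hwn⟩ := hF v
  exact ⟨w, hw, hwn.trans (by gcongr)⟩

theorem MapsWithBound.smul {V W E : Type*} [NormedAddCommGroup V] [NormedSpace ℂ V]
    [NormedAddCommGroup W] [NormedSpace ℂ W] [NormedAddCommGroup E] [NormedSpace ℂ E]
    {k : W →L[ℂ] E} {F : V → E} {c a : ℝ} (hF : MapsWithBound k F c) (ha : 0 ≤ a) :
    MapsWithBound k (fun v => a • F v) (a * c) := fun v => by
  obtain ⟨w, hw, hwn⟩ := hF v
  refine ⟨a • w, by rw [ContinuousLinearMap.map_smul_of_tower, hw], ?_⟩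
  rw [norm_smul, Real.norm_of_nonneg ha, mul_assoc]
  gcongr

/-- Product rule for a strongly differentiable family of operators applied to a curve. -/
theorem hasDerivWithinAt_clm_apply_of_bounded {X Y : Type*} [NormedAddCommGroup X]
    [NormedSpace ℂ X] [NormedAddCommGroup Y] [NormedSpace ℂ Y] {G : ℝ → X →L[ℂ] Y} {y : ℝ → X}
    {D : Set ℝ} {u M : ℝ} {y' : X} {g' : Y} (hM : ∀ σ ∈ D, ‖G σ‖ ≤ M)
    (hcont : ContinuousWithinAt (fun σ => G σ y') D u) (hy : HasDerivWithinAt y y' D u)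
    (hG : HasDerivWithinAt (fun σ => G σ (y u)) g' D u) :
    HasDerivWithinAt (fun σ => G σ (y σ)) (G u y' + g') D u := by
  rw [hasDerivWithinAt_iff_tendsto_slope] at hy hG ⊢
  have hle : 𝓝[D \ {u}] u ≤ 𝓝[D] u := nhdsWithin_mono _ sdiff_subset
  have h1 : Tendsto (fun σ => G σ (slope y u σ - y')) (𝓝[D \ {u}] u) (𝓝 0) := by
    have h0 : Tendsto (fun σ => M * ‖slope y u σ - y'‖) (𝓝[D \ {u}] u) (𝓝 0) := by
      have := ((hy.sub_const y').norm).const_mul M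
      simpa using this
    refine squeeze_zero_norm' ?_ h0
    filter_upwards [self_mem_nhdsWithin] with σ hσ
    exact (G σ).le_of_opNorm_le (hM σ hσ.1) _
  have h2 := (h1.add (hcont.mono_left hle)).add hG
  rw [zero_add] at h2
  refine h2.congr fun σ => ?_
  simp only [slope, vsub_eq_sub, map_sub, ContinuousLinearMap.map_smul_of_tower, smul_sub]
  abel

/-! ### Products of operators and telescoping -/

section stepProd

variable {X : Type*} [NormedAddCommGroup X] [NormedSpace ℂ X]

/-- The product `F (k + n - 1) ∘ ... ∘ F (k + 1) ∘ F k` of `n` consecutive operators. -/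
def stepProd (F : ℕ → X →L[ℂ] X) (k : ℕ) : ℕ → X →L[ℂ] X
  | 0 => ContinuousLinearMap.id ℂ X
  | n + 1 => F (k + n) ∘L stepProd F k n

theorem stepProd_zero (F : ℕ → X →L[ℂ] X) (k : ℕ) :
    stepProd F k 0 = ContinuousLinearMap.id ℂ X := rfl

theorem stepProd_succ_apply (F : ℕ → X →L[ℂ] X) (k n : ℕ) (x : X) :
    stepProd F k (n + 1) x = F (k + n) (stepProd F k n x) := rfl

theorem stepProd_add_apply (F : ℕ → X →L[ℂ] X) (k m n : ℕ) (x : X) :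
    stepProd F k (m + n) x = stepProd F (k + m) n (stepProd F k m x) := by
  induction n with
  | zero => rfl
  | succ n ih => rw [← add_assoc, stepProd_succ_apply, stepProd_succ_apply, ih, add_assoc]

theorem stepProd_block (F : ℕ → X →L[ℂ] X) (N k n : ℕ) :
    stepProd F (k * N) (n * N) = stepProd (fun i => stepProd F (i * N) N) k n := by
  induction n with
  | zero => simp [stepProd_zero]
  | succ n ih =>
    ext x
    rw [add_mul, one_mul, stepProd_add_apply, stepProd_succ_apply, ih, add_mul]

theorem orderedProd_eq_stepProd (μ : ℝ → ℝ → X →L[ℂ] X) (τ : ℕ → ℝ) (n : ℕ) :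
    orderedProd μ τ n = stepProd (fun i => μ (τ (i + 1)) (τ i)) 0 n := by
  induction n with
  | zero => rfl
  | succ n ih => rw [orderedProd, stepProd, ih, zero_add]

theorem norm_stepProd_le_exp_sum {F : ℕ → X →L[ℂ] X} {a : ℕ → ℝ} {k n : ℕ}
    (hF : ∀ i < n, ‖F (k + i)‖ ≤ Real.exp (a i)) :
    ‖stepProd F k n‖ ≤ Real.exp (∑ i ∈ Finset.range n, a i) := by
  induction n with
  | zero => simpa [stepProd_zero] using ContinuousLinearMap.norm_id_le
  | succ n ih =>
    rw [Finset.sum_range_succ, Real.exp_add, mul_comm (Real.exp _)]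
    exact (ContinuousLinearMap.opNorm_comp_le _ _).trans
      (mul_le_mul (hF n (by omega)) (ih fun i hi => hF i (by omega)) (norm_nonneg _)
        (Real.exp_pos _).le)

theorem norm_stepProd_le {F : ℕ → X →L[ℂ] X} {a : ℝ} (hF : ∀ i, ‖F i‖ ≤ Real.exp a) (k n : ℕ) :
    ‖stepProd F k n‖ ≤ Real.exp (n * a) := by
  simpa using norm_stepProd_le_exp_sum (a := fun _ => a) (k := k) (n := n) fun i _ => hF (k + i)

theorem map_stepProd {Y : Type*} [NormedAddCommGroup Y] [NormedSpace ℂ Y] {F : ℕ → X →L[ℂ] X}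
    {G : ℕ → Y →L[ℂ] Y} (k : X →L[ℂ] Y) (h : ∀ i x, k (F i x) = G i (k x)) (i n : ℕ) (x : X) :
    k (stepProd F i n x) = stepProd G i n (k x) := by
  induction n with
  | zero => rfl
  | succ n ih => rw [stepProd_succ_apply, stepProd_succ_apply, h, ih]

/-- Local errors add up to the global error (stability plus consistency). -/
theorem norm_stepProd_sub_le {F G : ℕ → X →L[ℂ] X} {a e : ℕ → ℝ} {k n : ℕ} {x : X}
    (ha : ∀ i < n, 0 ≤ a i) (hF : ∀ i < n, ‖F (k + i)‖ ≤ Real.exp (a i))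
    (he : ∀ i < n, ‖F (k + i) (stepProd G k i x) - G (k + i) (stepProd G k i x)‖ ≤ e i) :
    ‖stepProd F k n x - stepProd G k n x‖ ≤
      Real.exp (∑ i ∈ Finset.range n, a i) * ∑ i ∈ Finset.range n, e i := by
  induction n with
  | zero => simp [stepProd_zero]
  | succ n ih =>
    have ih' := ih (fun i hi => ha i (by omega)) (fun i hi => hF i (by omega))
      (fun i hi => he i (by omega))
    have hen := he n (by omega)
    have hsum : 0 ≤ ∑ i ∈ Finset.range n, a i :=
      Finset.sum_nonneg fun i hi => ha i (by have := Finset.mem_range.1 hi; omega)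
    have e1 : 1 ≤ Real.exp (∑ i ∈ Finset.range n, a i + a n) :=
      Real.one_le_exp (add_nonneg hsum (ha n (by omega)))
    rw [stepProd_succ_apply, stepProd_succ_apply, Finset.sum_range_succ, Finset.sum_range_succ]
    have hsplit : F (k + n) (stepProd F k n x) - G (k + n) (stepProd G k n x) =
        F (k + n) (stepProd F k n x - stepProd G k n x) +
        (F (k + n) (stepProd G k n x) - G (k + n) (stepProd G k n x)) := by
      rw [map_sub]; abel
    rw [hsplit]
    calc _ ≤ Real.exp (a n) * (Real.exp (∑ i ∈ Finset.range n, a i) *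
            ∑ i ∈ Finset.range n, e i) + e n :=
          (norm_add_le _ _).trans (add_le_add
            (((F (k + n)).le_of_opNorm_le (hF n (by omega)) _).trans (by gcongr)) hen)
      _ ≤ Real.exp (∑ i ∈ Finset.range n, a i + a n) * ∑ i ∈ Finset.range n, e i +
            Real.exp (∑ i ∈ Finset.range n, a i + a n) * e n := by
          have h0 : 0 ≤ e n := (norm_nonneg _).trans hen
          rw [← mul_assoc, ← Real.exp_add, add_comm (a n)]
          nlinarith
      _ = _ := by ring

/-- The version of `norm_stepProd_sub_le` for equal steps. -/
theorem norm_stepProd_sub_le_of_const {F G : ℕ → X →L[ℂ] X} {a e : ℝ} {k n : ℕ} {x : X}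
    (ha : 0 ≤ a) (hF : ∀ i, ‖F i‖ ≤ Real.exp a)
    (he : ∀ i < n, ‖F (k + i) (stepProd G k i x) - G (k + i) (stepProd G k i x)‖ ≤ e) :
    ‖stepProd F k n x - stepProd G k n x‖ ≤ Real.exp (n * a) * (n * e) := by
  have := norm_stepProd_sub_le (a := fun _ => a) (e := fun _ => e) (fun _ _ => ha)
    (fun i _ => hF (k + i)) he
  simpa using this

theorem stepProd_trans_apply (F : ℕ → X →L[ℂ] X) {i j l : ℕ} (hij : i ≤ j) (hjl : j ≤ l) (x : X) :
    stepProd F i (l - i) x = stepProd F j (l - j) (stepProd F i (j - i) x) := by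
  have h1 : l - i = (j - i) + (l - j) := by omega
  have h2 : i + (j - i) = j := by omega
  rw [h1, stepProd_add_apply, h2]

theorem stepProd_const_id (k n : ℕ) (x : X) :
    stepProd (fun _ => ContinuousLinearMap.id ℂ X) k n x = x := by
  induction n with
  | zero => rfl
  | succ n ih => rw [stepProd_succ_apply, ih]; rfl

theorem stepProd_const_succ_apply (J : X →L[ℂ] X) (k n : ℕ) (x : X) :
    stepProd (fun _ => J) k (n + 1) x = stepProd (fun _ => J) k n (J x) := by
  induction n with
  | zero => rfl
  | succ n ih => rw [stepProd_succ_apply, ih]; rfl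

theorem norm_stepProd_sub_self_le {F : ℕ → X →L[ℂ] X} {a e : ℝ} {k n : ℕ} {x : X}
    (ha : 0 ≤ a) (hF : ∀ i, ‖F i‖ ≤ Real.exp a) (he : ∀ i < n, ‖F (k + i) x - x‖ ≤ e) :
    ‖stepProd F k n x - x‖ ≤ Real.exp (n * a) * (n * e) := by
  have := norm_stepProd_sub_le_of_const (G := fun _ => ContinuousLinearMap.id ℂ X) (k := k)
    (n := n) (x := x) (e := e) ha hF (fun i hi => by
      rw [stepProd_const_id]; exact he i hi)
  rwa [stepProd_const_id] at this

end stepProd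

/-! ### Backward Euler schemes -/

section Euler

variable {X₀ X₁ X₂ : Type*}
  [NormedAddCommGroup X₀] [NormedSpace ℂ X₀]
  [NormedAddCommGroup X₁] [NormedSpace ℂ X₁]
  [NormedAddCommGroup X₂] [NormedSpace ℂ X₂]

/-- The backward Euler steps `(1 - h L_t)⁻¹` of a family `(L_t)` of unbounded operators, given
for all real times `t`, as operators `step₀`, `step₁`, `step₂` on the spaces `X₂ ⊆ X₁ ⊆ X₀`.
The family enters only through the bounded operators `gen t = L_t : X₁ → X₀` and
`genSq t = L_t² : X₂ → X₀`, of which only `gen` is bounded uniformly in `t`. That the steps invert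
`1 - h L_t` is expressed by `step_left` on one side, and by `step_apply` and `step_gen` on the other,
for the elements of `X₁` and of `L_t X₂` of the domain of `L_t`. -/
structure EulerScheme (ι₁ : X₁ →L[ℂ] X₀) (ι₂ : X₂ →L[ℂ] X₁) where
  gen : ℝ → X₁ →L[ℂ] X₀
  genSq : ℝ → X₂ →L[ℂ] X₀
  rate : ℝ
  rate_pos : 0 < rate
  maxStep : ℝ
  maxStep_pos : 0 < maxStep
  step₀ : ℝ → ℝ → X₀ →L[ℂ] X₀
  step₁ : ℝ → ℝ → X₁ →L[ℂ] X₁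
  step₂ : ℝ → ℝ → X₂ →L[ℂ] X₂
  norm_step₀_le : ∀ h t, 0 < h → h ≤ maxStep → ‖step₀ h t‖ ≤ Real.exp (rate * h)
  norm_step₁_le : ∀ h t, 0 < h → h ≤ maxStep → ‖step₁ h t‖ ≤ Real.exp (rate * h)
  norm_step₂_le : ∀ h t, 0 < h → h ≤ maxStep → ‖step₂ h t‖ ≤ Real.exp (rate * h)
  map_step₁ : ∀ h t x, 0 < h → h ≤ maxStep → ι₁ (step₁ h t x) = step₀ h t (ι₁ x)
  map_step₂ : ∀ h t x, 0 < h → h ≤ maxStep → ι₂ (step₂ h t x) = step₁ h t (ι₂ x)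
  step_apply : ∀ h t x, 0 < h → h ≤ maxStep → step₀ h t (ι₁ x) = ι₁ x + h • step₀ h t (gen t x)
  step_left : ∀ h t x, 0 < h → h ≤ maxStep →
    ι₁ (step₁ h t x) - h • gen t (step₁ h t x) = ι₁ x
  step_gen : ∀ h t x, 0 < h → h ≤ maxStep →
    step₀ h t (gen t (ι₂ x)) = gen t (ι₂ x) + h • step₀ h t (genSq t x)
  uniformContinuous_gen : UniformContinuous gen
  bounded_gen : ∃ K, ∀ t, ‖gen t‖ ≤ K

namespace EulerScheme

variable {ι₁ : X₁ →L[ℂ] X₀} {ι₂ : X₂ →L[ℂ] X₁} (E : EulerScheme ι₁ ι₂)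

/-- The product of the `n` Euler steps of size `h` from time `k h` to time `(k + n) h`. -/
def prod₀ (h : ℝ) (k n : ℕ) : X₀ →L[ℂ] X₀ := stepProd (fun i => E.step₀ h (i * h)) k n

/-- The restriction of `EulerScheme.prod₀` to `X₁`. -/
def prod₁ (h : ℝ) (k n : ℕ) : X₁ →L[ℂ] X₁ := stepProd (fun i => E.step₁ h (i * h)) k n

/-- The restriction of `EulerScheme.prod₀` to `X₂`. -/
def prod₂ (h : ℝ) (k n : ℕ) : X₂ →L[ℂ] X₂ := stepProd (fun i => E.step₂ h (i * h)) k n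

variable {h : ℝ}

theorem map_prod₁ (h0 : 0 < h) (hm : h ≤ E.maxStep) (k n : ℕ) (x : X₁) :
    ι₁ (E.prod₁ h k n x) = E.prod₀ h k n (ι₁ x) :=
  map_stepProd ι₁ (fun i x => E.map_step₁ h (i * h) x h0 hm) k n x

theorem map_prod₂ (h0 : 0 < h) (hm : h ≤ E.maxStep) (k n : ℕ) (x : X₂) :
    ι₂ (E.prod₂ h k n x) = E.prod₁ h k n (ι₂ x) :=
  map_stepProd ι₂ (fun i x => E.map_step₂ h (i * h) x h0 hm) k n x

theorem norm_prod₀_le (h0 : 0 < h) (hm : h ≤ E.maxStep) (k n : ℕ) :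
    ‖E.prod₀ h k n‖ ≤ Real.exp (n * (E.rate * h)) :=
  norm_stepProd_le (fun i => E.norm_step₀_le h (i * h) h0 hm) k n

theorem norm_prod₁_le (h0 : 0 < h) (hm : h ≤ E.maxStep) (k n : ℕ) :
    ‖E.prod₁ h k n‖ ≤ Real.exp (n * (E.rate * h)) :=
  norm_stepProd_le (fun i => E.norm_step₁_le h (i * h) h0 hm) k n

theorem norm_prod₂_le (h0 : 0 < h) (hm : h ≤ E.maxStep) (k n : ℕ) :
    ‖E.prod₂ h k n‖ ≤ Real.exp (n * (E.rate * h)) :=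
  norm_stepProd_le (fun i => E.norm_step₂_le h (i * h) h0 hm) k n

/-- Resolvent identity for Euler steps with frozen times `t` and `u`. -/
theorem step_sub_step (h0 : 0 < h) (hm : h ≤ E.maxStep) (t u : ℝ) (x : X₁) :
    E.step₀ h t (ι₁ x) - E.step₀ h u (ι₁ x) =
      h • E.step₀ h t ((E.gen t - E.gen u) (E.step₁ h u x)) := by
  have h1 := E.step_left h u x h0 hm
  have h2 := E.step_apply h t (E.step₁ h u x) h0 hm
  rw [← E.map_step₁ h u x h0 hm]
  conv_lhs => rw [← h1]
  rw [map_sub, h2, ContinuousLinearMap.map_smul_of_tower, sub_apply, map_sub, smul_sub]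
  abel

theorem norm_step_sub_self_le (h0 : 0 < h) (hm : h ≤ E.maxStep) {t : ℝ} {w q : X₀}
    (hw : E.step₀ h t w = w + h • E.step₀ h t q) :
    ‖E.step₀ h t w - w‖ ≤ h * (Real.exp (E.rate * h) * ‖q‖) := by
  rw [hw, add_sub_cancel_left, norm_smul, Real.norm_of_nonneg h0.le]
  gcongr
  exact (E.step₀ h t).le_of_opNorm_le (E.norm_step₀_le h t h0 hm) _

/-- First order expansion of a product of Euler steps with frozen time. The hypothesis on `w` says
that `w` lies in the domain of `L_u`, with `q = L_u w`; such a `w` serves to approximate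
`L_u z`. -/
theorem norm_frozen_sub_le (h0 : 0 < h) (hm : h ≤ E.maxStep) {u Λ : ℝ} {k n : ℕ} {z : X₁}
    {w q : X₀} (hΛ : Real.exp (E.rate * ((n + 1) * h)) ≤ Λ)
    (hw : E.step₀ h u w = w + h • E.step₀ h u q) :
    ‖stepProd (fun _ => E.step₀ h u) k n (ι₁ z) - ι₁ z - (n * h) • E.gen u z‖ ≤
      n * h * ((Λ + 1) * ‖E.gen u z - w‖ + Λ * (n * h) * ‖q‖) := by
  have hr := E.rate_pos
  have ha : 0 ≤ E.rate * h := by positivity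
  have hΛ0 : 0 ≤ Λ := (Real.exp_pos _).le.trans hΛ
  have hJ : ∀ _ : ℕ, ‖E.step₀ h u‖ ≤ Real.exp (E.rate * h) := fun _ => E.norm_step₀_le h u h0 hm
  set J := E.step₀ h u
  set P := stepProd (fun _ : ℕ => J) k
  -- on the generator, all shorter products are close to the identity
  have key : ∀ i ≤ n, ‖P i (E.gen u z) - E.gen u z‖ ≤
      (Λ + 1) * ‖E.gen u z - w‖ + Λ * (n * h) * ‖q‖ := by
    intro i hi
    have hi' : (i : ℝ) ≤ n := by exact_mod_cast hi
    have hP : ‖P i‖ ≤ Λ := (norm_stepProd_le hJ k i).trans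
      (le_trans (Real.exp_le_exp.2 (by nlinarith)) hΛ)
    have h1 : ‖P i w - w‖ ≤ Λ * (n * h) * ‖q‖ := by
      have := norm_stepProd_sub_self_le (k := k) (n := i) (x := w) ha hJ
        (fun _ _ => E.norm_step_sub_self_le h0 hm hw)
      refine this.trans ?_
      calc Real.exp (i * (E.rate * h)) * (i * (h * (Real.exp (E.rate * h) * ‖q‖)))
          = Real.exp (i * (E.rate * h) + E.rate * h) * (i * h) * ‖q‖ := by
            rw [Real.exp_add]; ring
        _ ≤ Λ * (n * h) * ‖q‖ := by
            gcongr
            refine le_trans (Real.exp_le_exp.2 ?_) hΛ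
            nlinarith
    have h2 : P i (E.gen u z) - E.gen u z =
        P i (E.gen u z - w) + (P i w - w) - (E.gen u z - w) := by rw [map_sub]; abel
    rw [h2]
    calc _ ≤ ‖P i (E.gen u z - w)‖ + ‖P i w - w‖ + ‖E.gen u z - w‖ :=
          (norm_sub_le _ _).trans (add_le_add_left (norm_add_le _ _) _)
      _ ≤ Λ * ‖E.gen u z - w‖ + Λ * (n * h) * ‖q‖ + ‖E.gen u z - w‖ := by
          gcongr; exact (P i).le_of_opNorm_le hP _
      _ = _ := by ring
  set b := (Λ + 1) * ‖E.gen u z - w‖ + Λ * (n * h) * ‖q‖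
  have ind : ∀ m ≤ n, ‖P m (ι₁ z) - ι₁ z - (m * h) • E.gen u z‖ ≤ m * h * b := by
    intro m
    induction m with
    | zero => intro _; simp [P, stepProd_zero]
    | succ m ih =>
      intro hm'
      have h1 : P (m + 1) (ι₁ z) - ι₁ z - ((m + 1 : ℕ) * h) • E.gen u z =
          (P m (ι₁ z) - ι₁ z - (m * h) • E.gen u z) +
            h • (P (m + 1) (E.gen u z) - E.gen u z) := by
        simp only [P]
        rw [stepProd_const_succ_apply, stepProd_const_succ_apply, E.step_apply h u z h0 hm, map_add,
          ContinuousLinearMap.map_smul_of_tower]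
        push_cast
        rw [add_mul, one_mul, add_smul, smul_sub]
        abel
      rw [h1]
      calc _ ≤ m * h * b + h * b := by
            refine (norm_add_le _ _).trans (add_le_add (ih (by omega)) ?_)
            rw [norm_smul, Real.norm_of_nonneg h0.le]
            gcongr
            exact key _ hm'
        _ = _ := by push_cast; ring
  exact ind n le_rfl

/-- First order expansion of a product of Euler steps over a time interval on which `gen` is
nearly constant. -/
theorem norm_prod_sub_le (h0 : 0 < h) (hm : h ≤ E.maxStep) {u η Λ : ℝ} {k n : ℕ} {z : X₁}
    {w q : X₀} (hΛ : Real.exp (E.rate * ((n + 1) * h)) ≤ Λ)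
    (hη : ∀ i < n, ‖E.gen ((k + i : ℕ) * h) - E.gen u‖ ≤ η)
    (hw : E.step₀ h u w = w + h • E.step₀ h u q) :
    ‖E.prod₀ h k n (ι₁ z) - ι₁ z - (n * h) • E.gen u z‖ ≤
      n * h * (Λ ^ 3 * η * ‖z‖ + (Λ + 1) * ‖E.gen u z - w‖ + Λ * (n * h) * ‖q‖) := by
  have hr := E.rate_pos
  have ha : 0 ≤ E.rate * h := by positivity
  have h1 := E.norm_frozen_sub_le h0 hm (k := k) (z := z) hΛ hw
  have hexp : ∀ i ≤ n + 1, Real.exp (i * (E.rate * h)) ≤ Λ := by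
    intro i hi
    have hi' : (i : ℝ) ≤ n + 1 := by exact_mod_cast hi
    refine le_trans (Real.exp_le_exp.2 ?_) hΛ
    nlinarith
  have hΛ0 : 0 ≤ Λ := (Real.exp_pos _).le.trans hΛ
  have h2 : ‖E.prod₀ h k n (ι₁ z) - stepProd (fun _ => E.step₀ h u) k n (ι₁ z)‖ ≤
      n * h * (Λ ^ 3 * η * ‖z‖) := by
    have := norm_stepProd_sub_le_of_const (F := fun i : ℕ => E.step₀ h (i * h))
      (G := fun _ => E.step₀ h u) (k := k) (n := n) (x := ι₁ z) (e := h * (Λ ^ 2 * η * ‖z‖)) ha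
      (fun i => E.norm_step₀_le h (i * h) h0 hm) (fun i hi => by
        rw [← map_stepProd (F := fun _ => E.step₁ h u) ι₁
          (fun _ x => E.map_step₁ h u x h0 hm), E.step_sub_step h0 hm, norm_smul,
          Real.norm_of_nonneg h0.le]
        have a1 : ‖stepProd (fun _ => E.step₁ h u) k (i + 1) z‖ ≤ Λ * ‖z‖ :=
          ContinuousLinearMap.le_of_opNorm_le _
            ((norm_stepProd_le (fun _ => E.norm_step₁_le h u h0 hm) k (i + 1)).trans
              (hexp _ (by omega))) _
        rw [stepProd_succ_apply] at a1
        have a2 : Real.exp (E.rate * h) ≤ Λ := by simpa using hexp 1 (by omega)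
        gcongr
        refine ((E.step₀ h _).le_of_opNorm_le ((E.norm_step₀_le h _ h0 hm).trans a2) _).trans ?_
        have hη0 : 0 ≤ η := (norm_nonneg _).trans (hη i hi)
        calc _ ≤ Λ * (η * (Λ * ‖z‖)) := by
              gcongr
              exact (ContinuousLinearMap.le_of_opNorm_le _ (hη i hi) _).trans (by gcongr)
          _ = _ := by ring)
    refine this.trans ?_
    have hs : 0 ≤ n * (h * (Λ ^ 2 * η * ‖z‖)) := by
      rcases Nat.eq_zero_or_pos n with rfl | hn
      · simp
      · have hη0 : 0 ≤ η := (norm_nonneg _).trans (hη 0 hn)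
        positivity
    calc _ ≤ Λ * (n * (h * (Λ ^ 2 * η * ‖z‖))) := by
          gcongr; exact hexp n (by omega)
      _ = _ := by ring
  have h3 : E.prod₀ h k n (ι₁ z) - ι₁ z - (n * h) • E.gen u z =
      (E.prod₀ h k n (ι₁ z) - stepProd (fun _ => E.step₀ h u) k n (ι₁ z)) +
      (stepProd (fun _ => E.step₀ h u) k n (ι₁ z) - ι₁ z - (n * h) • E.gen u z) := by abel
  rw [h3]
  exact (norm_add_le _ _).trans ((add_le_add h2 h1).trans_eq (by ring))

theorem norm_prod_sub_self_le (h0 : 0 < h) (hm : h ≤ E.maxStep) {K Λ : ℝ} {k n : ℕ} {z : X₁}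
    (hK : ∀ t, ‖E.gen t‖ ≤ K) (hΛ : Real.exp (E.rate * ((n + 1) * h)) ≤ Λ) :
    ‖E.prod₀ h k n (ι₁ z) - ι₁ z‖ ≤ n * h * (Λ * K * ‖z‖) := by
  have hr := E.rate_pos
  have hK0 : 0 ≤ K := (norm_nonneg _).trans (hK 0)
  have ha : 0 ≤ E.rate * h := by positivity
  have := norm_stepProd_sub_self_le (F := fun i : ℕ => E.step₀ h (i * h)) (k := k) (n := n)
    (x := ι₁ z) (e := h * (Real.exp (E.rate * h) * (K * ‖z‖))) ha
    (fun i => E.norm_step₀_le h (i * h) h0 hm) (fun i _ =>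
      (E.norm_step_sub_self_le h0 hm (E.step_apply h _ z h0 hm)).trans (by
        gcongr; exact ContinuousLinearMap.le_of_opNorm_le _ (hK _) _))
  refine this.trans ?_
  calc _ = Real.exp (n * (E.rate * h) + E.rate * h) * (n * h * (K * ‖z‖)) := by
        rw [Real.exp_add]; ring
    _ ≤ Λ * (n * h * (K * ‖z‖)) := by
        gcongr
        exact le_trans (Real.exp_le_exp.2 (by linarith)) hΛ
    _ = _ := by ring

/-- Every time is close to one of finitely many times, where `genSq` is bounded. -/
theorem exists_net {δ : ℝ} (hδ : 0 < δ) (t : ℝ) :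
    ∃ C, ∀ u, 0 ≤ u → u ≤ t → ∃ v, v ≤ u ∧ u < v + δ ∧ ‖E.genSq v‖ ≤ C := by
  refine ⟨∑ j ∈ Finset.range (⌊t / δ⌋₊ + 1), ‖E.genSq (j * δ)‖, fun u hu hut =>
    ⟨⌊u / δ⌋₊ * δ, ?_, ?_, ?_⟩⟩
  · rw [← le_div_iff₀ hδ]; exact Nat.floor_le (by positivity)
  · have := Nat.lt_floor_add_one (u / δ)
    rw [div_lt_iff₀ hδ] at this
    linarith
  · refine Finset.single_le_sum (f := fun j : ℕ => ‖E.genSq (j * δ)‖)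
      (fun _ _ => norm_nonneg _) (Finset.mem_range.2 ?_)
    exact Nat.lt_succ_of_le (Nat.floor_le_floor (by gcongr))

/-- The approximation of the propagator from time `s` to time `t` by Euler steps of size `h`. -/
def approx (h t s : ℝ) : X₀ →L[ℂ] X₀ := E.prod₀ h ⌊s / h⌋₊ (⌊t / h⌋₊ - ⌊s / h⌋₊)

end EulerScheme
end Euler

/-! ### Refinement of Euler steps -/

section EulerLimit

variable {X₀ X₁ X₂ : Type*}
  [NormedAddCommGroup X₀] [NormedSpace ℂ X₀]
  [NormedAddCommGroup X₁] [NormedSpace ℂ X₁]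
  [NormedAddCommGroup X₂] [NormedSpace ℂ X₂]

namespace EulerScheme

variable {ι₁ : X₁ →L[ℂ] X₀} {ι₂ : X₂ →L[ℂ] X₁} (E : EulerScheme ι₁ ι₂)

variable {h : ℝ}

/-- On `X₂` one Euler step of size `h` nearly agrees with `N` steps of size `h / N`. -/
theorem norm_prod_div_sub_step_le (h0 : 0 < h) (hm : h ≤ E.maxStep) {N k : ℕ} (hN : 0 < N)
    {u η Λ C : ℝ} {y : X₂} (hΛ : Real.exp (E.rate * (2 * h)) ≤ Λ)
    (hη : ∀ r, k * h ≤ r → r ≤ (k + 1) * h → ‖E.gen r - E.gen u‖ ≤ η)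
    (hC : ‖E.genSq u‖ ≤ C) :
    ‖E.prod₀ (h / N) (k * N) N (ι₁ (ι₂ y)) - E.step₀ h (k * h) (ι₁ (ι₂ y))‖ ≤
      h * (2 * (Λ ^ 3 * η * (‖ι₂‖ * ‖y‖) + Λ * h * (C * ‖y‖))) := by
  have hr := E.rate_pos
  have hN' : (0 : ℝ) < N := by exact_mod_cast hN
  have hN1 : (1 : ℝ) ≤ N := by exact_mod_cast hN
  have hd0 : 0 < h / N := by positivity
  have hdh : h / N ≤ h := div_le_self h0.le hN1
  have hNh : N * (h / N) = h := by field_simp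
  have hη0 : 0 ≤ η := (norm_nonneg _).trans (hη (k * h) le_rfl (by nlinarith))
  have hΛ0 : 0 ≤ Λ := (Real.exp_pos _).le.trans hΛ
  have hb : Λ ^ 3 * η * ‖ι₂ y‖ + (Λ + 1) * ‖E.gen u (ι₂ y) - E.gen u (ι₂ y)‖ +
      Λ * h * ‖E.genSq u y‖ ≤ Λ ^ 3 * η * (‖ι₂‖ * ‖y‖) + Λ * h * (C * ‖y‖) := by
    rw [sub_self, norm_zero, mul_zero, add_zero]
    gcongr
    · exact ι₂.le_opNorm y
    · exact ContinuousLinearMap.le_of_opNorm_le _ hC y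
  have h1 := E.norm_prod_sub_le hd0 (hdh.trans hm) (u := u) (η := η) (Λ := Λ) (k := k * N) (n := N)
    (z := ι₂ y) (w := E.gen u (ι₂ y)) (q := E.genSq u y)
    (le_trans (Real.exp_le_exp.2 (by rw [add_mul, hNh]; nlinarith)) hΛ)
    (fun i hi => by
      have hi' : (i : ℝ) ≤ N := by exact_mod_cast hi.le
      have e1 : ((k * N + i : ℕ) : ℝ) * (h / N) = k * h + i * (h / N) := by
        push_cast; field_simp
      have e2 : i * (h / N) ≤ h := by
        calc i * (h / N) ≤ N * (h / N) := by gcongr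
          _ = h := hNh
      have e3 : 0 ≤ i * (h / N) := by positivity
      rw [e1]
      exact hη _ (by linarith) (by linarith))
    (E.step_gen _ u y hd0 (hdh.trans hm))
  have h2 := E.norm_prod_sub_le h0 hm (u := u) (η := η) (Λ := Λ) (k := k) (n := 1)
    (z := ι₂ y) (w := E.gen u (ι₂ y)) (q := E.genSq u y)
    (le_trans (Real.exp_le_exp.2 (by push_cast; nlinarith)) hΛ)
    (fun i hi => by
      obtain rfl : i = 0 := by omega
      exact hη _ (by simp) (by push_cast; nlinarith))
    (E.step_gen _ u y h0 hm)
  rw [hNh] at h1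
  rw [Nat.cast_one, one_mul] at h2
  have h3 : E.prod₀ h k 1 = E.step₀ h (k * h) := rfl
  rw [h3] at h2
  rw [← sub_sub_sub_cancel_right _ _ (ι₁ (ι₂ y)),
    ← sub_sub_sub_cancel_right _ _ (h • E.gen u (ι₂ y))]
  refine (norm_sub_le _ _).trans ((add_le_add h1 h2).trans ?_)
  have := mul_le_mul_of_nonneg_left hb h0.le
  linarith

/-- On `X₂` a product of `n` Euler steps hardly changes when every step is divided into `N`. -/
theorem norm_prod_div_sub_prod_le (h0 : 0 < h) (hm : h ≤ E.maxStep) {N i n : ℕ} (hN : 0 < N)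
    {t η Λ C : ℝ} {x : X₂} (hC0 : 0 ≤ C) (hΛ : ∀ r ≤ t + 2 * h, Real.exp (E.rate * r) ≤ Λ)
    (hn : ((i + n : ℕ) : ℝ) * h ≤ t)
    (hnet : ∀ u, 0 ≤ u → u ≤ t → ∃ v, (∀ r, u ≤ r → r ≤ u + h → ‖E.gen r - E.gen v‖ ≤ η) ∧
      ‖E.genSq v‖ ≤ C) :
    ‖E.prod₀ (h / N) (i * N) (n * N) (ι₁ (ι₂ x)) - E.prod₀ h i n (ι₁ (ι₂ x))‖ ≤
      Λ * (n * (h * (2 * (Λ ^ 3 * η * (‖ι₂‖ * (Λ * ‖x‖)) + Λ * h * (C * (Λ * ‖x‖)))))) := by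
  have hr := E.rate_pos
  have hN1 : (1 : ℝ) ≤ N := by exact_mod_cast hN
  have hd0 : 0 < h / N := by positivity
  have hdm : h / N ≤ E.maxStep := (div_le_self h0.le hN1).trans hm
  have ht : 0 ≤ t := le_trans (by positivity) hn
  have hΛ0 : 0 ≤ Λ := (Real.exp_pos _).le.trans (hΛ 0 (by positivity))
  have hη : 0 ≤ η := by
    obtain ⟨v, hv, -⟩ := hnet 0 le_rfl ht
    exact (norm_nonneg _).trans (hv 0 le_rfl (by linarith))
  have hblock : E.prod₀ (h / N) (i * N) (n * N) =
      stepProd (fun l => E.prod₀ (h / N) (l * N) N) i n := stepProd_block _ N i n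
  have hle : ∀ l ≤ i + n, (l : ℝ) * h ≤ t := fun l hl => le_trans (by gcongr) hn
  rw [hblock]
  refine (norm_stepProd_sub_le_of_const (F := fun l => E.prod₀ (h / N) (l * N) N)
    (a := E.rate * h) (by positivity)
    (fun l => (E.norm_prod₀_le hd0 hdm _ _).trans_eq (by field_simp)) fun l hl => ?_).trans
    (mul_le_mul_of_nonneg_right ((Real.exp_le_exp.2 (le_of_eq ?_)).trans
      (hΛ (n * h) (by linarith [hle n (by omega)]))) (by positivity))
  · have c1 : stepProd (fun l : ℕ => E.step₀ h (l * h)) i l (ι₁ (ι₂ x)) =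
        ι₁ (ι₂ (E.prod₂ h i l x)) := by
      rw [E.map_prod₂ h0 hm, E.map_prod₁ h0 hm]; rfl
    have c2 : ‖E.prod₂ h i l x‖ ≤ Λ * ‖x‖ := ContinuousLinearMap.le_of_opNorm_le _
      ((E.norm_prod₂_le h0 hm _ _).trans ((Real.exp_le_exp.2 (by linarith)).trans
        (hΛ (l * h) (by linarith [hle l (by omega)])))) _
    obtain ⟨v, v1, v2⟩ := hnet (((i + l : ℕ) : ℝ) * h) (by positivity) (hle _ (by omega))
    rw [c1]
    refine (E.norm_prod_div_sub_step_le h0 hm (k := i + l) hN (hΛ _ (by linarith))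
      (fun r r1 r2 => v1 r r1 (by linarith)) v2).trans ?_
    gcongr
  · ring

/-- Refining the steps hardly changes the approximation on `X₂`. -/
theorem exists_norm_approx_sub_le (x : X₂) {s t ε : ℝ} (hs : 0 ≤ s) (hst : s ≤ t) (hε : 0 < ε) :
    ∃ δ > 0, ∀ h, 0 < h → h < δ → ∀ N : ℕ, 0 < N →
      ‖E.approx (h / N) t s (ι₁ (ι₂ x)) - E.approx h t s (ι₁ (ι₂ x))‖ ≤ ε := by
  obtain ⟨K, hK⟩ := E.bounded_gen
  have hr := E.rate_pos
  have hK0 : 0 ≤ K := (norm_nonneg _).trans (hK 0)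
  have ht : 0 ≤ t := hs.trans hst
  set Λ := Real.exp (E.rate * (t + 2))
  have hΛ0 : 0 ≤ Λ := (Real.exp_pos _).le
  have hΛ : ∀ r : ℝ, r ≤ t + 2 → Real.exp (E.rate * r) ≤ Λ := fun r hr =>
    Real.exp_le_exp.2 (by gcongr)
  clear_value Λ
  set κ := ‖ι₂‖
  set a₁ := Λ * t * (2 * (Λ ^ 3 * (κ * (Λ * ‖x‖))))
  have ha₁ : 0 ≤ a₁ := by positivity
  set η := ε / (2 * (a₁ + 1))
  have hη : 0 < η := by positivity
  obtain ⟨δ₁, hδ₁, hgen⟩ := Metric.uniformContinuous_iff.1 E.uniformContinuous_gen η hη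
  obtain ⟨C, hC⟩ := E.exists_net (half_pos hδ₁) t
  set a₂ := Λ * t * (2 * (Λ * (|C| * (Λ * ‖x‖)))) + 2 * (Λ * (Λ * K * (κ * ‖x‖)))
  have ha₂ : 0 ≤ a₂ := by positivity
  have hmain : a₁ * η ≤ ε / 2 := by
    have : a₁ * η = ε / 2 * (a₁ / (a₁ + 1)) := by simp only [η]; field_simp
    rw [this]
    exact mul_le_of_le_one_right (by positivity) ((div_le_one (by positivity)).2 (by linarith))
  refine ⟨min (min E.maxStep 1) (min (δ₁ / 2) (ε / (2 * (a₂ + 1)))), ?_, ?_⟩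
  · have := E.maxStep_pos
    positivity
  intro h h0 hδ N hN
  obtain ⟨⟨hm, h1⟩, hδ2, hε2⟩ := by simpa only [lt_min_iff] using hδ
  have hN' : (0 : ℝ) < N := by exact_mod_cast hN
  have hN1 : (1 : ℝ) ≤ N := by exact_mod_cast hN
  set d := h / N with hd
  have hd0 : 0 < d := by positivity
  have hdh : d ≤ h := div_le_self h0.le hN1
  have hdm := hdh.trans hm.le
  have hNd : N * d = h := by rw [hd]; field_simp
  set i := ⌊s / h⌋₊
  set j := ⌊t / h⌋₊
  set i' := ⌊s / d⌋₊
  set j' := ⌊t / d⌋₊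
  have hij : i ≤ j := Nat.floor_le_floor (by gcongr)
  have hij' : i' ≤ j' := Nat.floor_le_floor (by gcongr)
  have hdiv : ∀ r : ℝ, r / h * N = r / d := by intro r; rw [← hNd]; field_simp
  -- the end points of the coarse grid precede those of the fine grid by less than `h`
  have hfl : ∀ r : ℝ, 0 ≤ r → ⌊r / h⌋₊ * N ≤ ⌊r / d⌋₊ ∧ ⌊r / d⌋₊ ≤ ⌊r / h⌋₊ * N + N ∧
      ⌊r / h⌋₊ * h ≤ r ∧ ⌊r / d⌋₊ * d ≤ r := by
    intro r hr0
    have b1 := Nat.floor_le (show 0 ≤ r / h by positivity)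
    have b2 := Nat.floor_le (show 0 ≤ r / d by positivity)
    have b3 := (Nat.lt_floor_add_one (r / h)).le
    refine ⟨Nat.le_floor ?_, ?_, (le_div_iff₀ h0).1 b1, (le_div_iff₀ hd0).1 b2⟩
    · rw [← hdiv]; push_cast; gcongr
    · have : (⌊r / d⌋₊ : ℝ) ≤ ((⌊r / h⌋₊ * N + N : ℕ) : ℝ) := by
        refine b2.trans ?_
        rw [← hdiv]; push_cast
        calc r / h * N ≤ (⌊r / h⌋₊ + 1) * N := by gcongr
          _ = _ := by ring
      exact_mod_cast this
  obtain ⟨s1, s2, s3, s4⟩ : i * N ≤ i' ∧ i' ≤ i * N + N ∧ i * h ≤ s ∧ i' * d ≤ s := hfl s hs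
  obtain ⟨t1, t2, t3, t4⟩ : j * N ≤ j' ∧ j' ≤ j * N + N ∧ j * h ≤ t ∧ j' * d ≤ t := hfl t ht
  have hiN : i * N ≤ j * N := by gcongr
  -- three sources of error
  have e1 : ‖E.prod₀ d i' (j' - i') (ι₁ (ι₂ x)) - E.prod₀ d (i * N) (j' - i * N) (ι₁ (ι₂ x))‖ ≤
      Λ * (h * (Λ * K * (κ * ‖x‖))) := by
    have a1 : E.prod₀ d (i * N) (j' - i * N) (ι₁ (ι₂ x)) =
        E.prod₀ d i' (j' - i') (E.prod₀ d (i * N) (i' - i * N) (ι₁ (ι₂ x))) :=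
      stepProd_trans_apply _ s1 hij' _
    have b1 : ((i' - i * N : ℕ) : ℝ) * d ≤ h := by
      rw [← hNd]
      gcongr
      omega
    have b2 : ((j' - i' : ℕ) : ℝ) * d ≤ t :=
      le_trans (by gcongr; omega) t4
    have b3 := E.norm_prod_sub_self_le hd0 hdm (k := i * N) (n := i' - i * N) (z := ι₂ x) hK
      (hΛ _ (by linarith))
    have b4 : ‖E.prod₀ d i' (j' - i')‖ ≤ Λ :=
      (E.norm_prod₀_le hd0 hdm _ _).trans
        ((Real.exp_le_exp.2 (by linarith)).trans (hΛ (_ * d) (b2.trans (by linarith))))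
    rw [a1, norm_sub_rev, ← map_sub]
    refine (ContinuousLinearMap.le_of_opNorm_le _ b4 _).trans ?_
    gcongr
    refine b3.trans ?_
    gcongr
    exact ι₂.le_opNorm x
  have e2 : ‖E.prod₀ d (i * N) (j' - i * N) (ι₁ (ι₂ x)) -
      E.prod₀ d (i * N) (j * N - i * N) (ι₁ (ι₂ x))‖ ≤ h * (Λ * K * (Λ * (κ * ‖x‖))) := by
    have a1 : E.prod₀ d (i * N) (j' - i * N) (ι₁ (ι₂ x)) =
        E.prod₀ d (j * N) (j' - j * N) (E.prod₀ d (i * N) (j * N - i * N) (ι₁ (ι₂ x))) :=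
      stepProd_trans_apply _ hiN t1 _
    have b1 : ((j' - j * N : ℕ) : ℝ) * d ≤ h := by
      rw [← hNd]
      gcongr
      omega
    have b2 : ((j * N - i * N : ℕ) : ℝ) * d ≤ t :=
      le_trans (by gcongr; omega) t4
    rw [a1, ← E.map_prod₁ hd0 hdm]
    refine (E.norm_prod_sub_self_le hd0 hdm hK (hΛ _ (by linarith))).trans ?_
    have b4 : ‖E.prod₁ d (i * N) (j * N - i * N)‖ ≤ Λ :=
      (E.norm_prod₁_le hd0 hdm _ _).trans
        ((Real.exp_le_exp.2 (by linarith)).trans (hΛ (_ * d) (b2.trans (by linarith))))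
    gcongr
    exact (ContinuousLinearMap.le_of_opNorm_le _ b4 _).trans (by gcongr; exact ι₂.le_opNorm x)
  have hji : ((j - i : ℕ) : ℝ) * h ≤ t := le_trans (by gcongr; omega) t3
  have e3 : ‖E.prod₀ d (i * N) (j * N - i * N) (ι₁ (ι₂ x)) - E.prod₀ h i (j - i) (ι₁ (ι₂ x))‖ ≤
      Λ * ((j - i : ℕ) * (h * (2 * (Λ ^ 3 * η * (κ * (Λ * ‖x‖)) +
        Λ * h * (|C| * (Λ * ‖x‖)))))) := by
    rw [← Nat.sub_mul]
    refine E.norm_prod_div_sub_prod_le h0 hm.le hN (t := t) (abs_nonneg C)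
      (fun r hr => hΛ r (by linarith)) (le_trans (by gcongr; omega) t3)
      (fun u hu hut => ?_)
    obtain ⟨v, v1, v2, v3⟩ := hC u hu hut
    refine ⟨v, fun r r1 r2 => ?_, v3.trans (le_abs_self C)⟩
    rw [← dist_eq_norm]
    refine (hgen ?_).le
    rw [Real.dist_eq, abs_lt]
    constructor <;> linarith
  have hfin : E.approx d t s (ι₁ (ι₂ x)) - E.approx h t s (ι₁ (ι₂ x)) =
      (E.prod₀ d i' (j' - i') (ι₁ (ι₂ x)) - E.prod₀ d (i * N) (j' - i * N) (ι₁ (ι₂ x))) +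
      (E.prod₀ d (i * N) (j' - i * N) (ι₁ (ι₂ x)) -
        E.prod₀ d (i * N) (j * N - i * N) (ι₁ (ι₂ x))) +
      (E.prod₀ d (i * N) (j * N - i * N) (ι₁ (ι₂ x)) - E.prod₀ h i (j - i) (ι₁ (ι₂ x))) := by
    simp only [approx]
    abel
  rw [hfin]
  refine (norm_add₃_le).trans ((add_le_add_three e1 e2 e3).trans ?_)
  have f1 : Λ * ((j - i : ℕ) * (h * (2 * (Λ ^ 3 * η * (κ * (Λ * ‖x‖)) +
        Λ * h * (|C| * (Λ * ‖x‖)))))) ≤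
      Λ * (t * (2 * (Λ ^ 3 * η * (κ * (Λ * ‖x‖)) + Λ * h * (|C| * (Λ * ‖x‖))))) := by
    rw [← mul_assoc (_ : ℝ) h]
    gcongr
  have f2 : a₂ * h ≤ ε / 2 := by
    have : h * (2 * (a₂ + 1)) < ε := (lt_div_iff₀ (by positivity)).1 hε2
    linarith
  calc _ ≤ Λ * (h * (Λ * K * (κ * ‖x‖))) + h * (Λ * K * (Λ * (κ * ‖x‖))) +
        Λ * (t * (2 * (Λ ^ 3 * η * (κ * (Λ * ‖x‖)) + Λ * h * (|C| * (Λ * ‖x‖))))) := by gcongr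
    _ = a₁ * η + a₂ * h := by ring
    _ ≤ ε := by linarith

end EulerScheme
end EulerLimit

/-! ### The limit of the Euler approximations -/

section EulerPropagator

variable {X₀ X₁ X₂ : Type*}
  [NormedAddCommGroup X₀] [NormedSpace ℂ X₀]
  [NormedAddCommGroup X₁] [NormedSpace ℂ X₁]
  [NormedAddCommGroup X₂] [NormedSpace ℂ X₂]

/-- A sequence of operators that is bounded in norm and Cauchy on a dense set converges strongly. -/
theorem exists_clm_tendsto_of_cauchySeq {X : Type*} [NormedAddCommGroup X] [NormedSpace ℂ X]
    [CompleteSpace X] {V : Type*} {j : V → X} (hj : DenseRange j) {F : ℕ → X →L[ℂ] X} {M : ℝ}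
    (hM : ∀ᶠ n in atTop, ‖F n‖ ≤ M) (hF : ∀ v, CauchySeq fun n => F n (j v)) :
    ∃ S : X →L[ℂ] X, ∀ x, Tendsto (fun n => F n x) atTop (𝓝 (S x)) := by
  have key : ∀ x, ∃ y, Tendsto (fun n => F n x) atTop (𝓝 y) := by
    intro x
    refine cauchySeq_tendsto_of_complete (Metric.cauchySeq_iff'.2 fun ε hε => ?_)
    obtain ⟨N₀, hN₀⟩ := eventually_atTop.1 hM
    have hM0 : 0 ≤ M := (norm_nonneg _).trans (hN₀ N₀ le_rfl)
    obtain ⟨v, hv⟩ := hj.exists_dist_lt x (show 0 < ε / (3 * (M + 1)) by positivity)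
    obtain ⟨N₁, hN₁⟩ := Metric.cauchySeq_iff.1 (hF v) (ε / 3) (by positivity)
    have hx : ∀ n ≥ max N₀ N₁, dist (F n x) (F n (j v)) ≤ ε / 3 := by
      intro n hn
      rw [dist_eq_norm, ← map_sub]
      refine ((F n).le_of_opNorm_le (hN₀ n (le_of_max_le_left hn)) _).trans ?_
      rw [← dist_eq_norm]
      calc M * dist x (j v) ≤ (M + 1) * (ε / (3 * (M + 1))) := by gcongr; linarith
        _ = ε / 3 := by field_simp
    refine ⟨max N₀ N₁, fun n hn => ?_⟩
    have h1 := hx n hn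
    have h2 := hx _ le_rfl
    have h3 := hN₁ n (le_of_max_le_right hn) (max N₀ N₁) (le_max_right _ _)
    have h4 := dist_triangle4 (F n x) (F n (j v)) (F (max N₀ N₁) (j v)) (F (max N₀ N₁) x)
    rw [dist_comm (F (max N₀ N₁) (j v))] at h4
    linarith
  choose f hf using key
  exact ⟨continuousLinearMapOfTendsto (𝕜₁ := ℂ) F (tendsto_pi_nhds.2 hf), hf⟩

/-- Floors of `t / h` and `s / h` count the steps of size `h` from `s` to `t`. -/
theorem tendsto_floor_sub_mul {s t : ℝ} (hs : 0 ≤ s) (hst : s ≤ t) {h : ℕ → ℝ} (h0 : ∀ n, 0 < h n)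
    (hlim : Tendsto h atTop (𝓝 0)) :
    Tendsto (fun n => ((⌊t / h n⌋₊ - ⌊s / h n⌋₊ : ℕ) : ℝ) * h n) atTop (𝓝 (t - s)) := by
  rw [tendsto_iff_dist_tendsto_zero]
  refine squeeze_zero (fun _ => dist_nonneg) (fun n => ?_) hlim
  have hn := h0 n
  have a1 := Nat.floor_le (show 0 ≤ s / h n by positivity)
  have a2 := (Nat.lt_floor_add_one (s / h n)).le
  have b1 := Nat.floor_le (show 0 ≤ t / h n from div_nonneg (hs.trans hst) hn.le)
  have b2 := (Nat.lt_floor_add_one (t / h n)).le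
  rw [le_div_iff₀ hn] at a1 b1
  rw [div_le_iff₀ hn] at a2 b2
  rw [Nat.cast_sub (Nat.floor_le_floor (by gcongr)), Real.dist_eq, abs_le]
  constructor <;> linarith

namespace EulerScheme

variable {ι₁ : X₁ →L[ℂ] X₀} {ι₂ : X₂ →L[ℂ] X₁} (E : EulerScheme ι₁ ι₂)

theorem eventually_exp_le {s t r : ℝ} (hs : 0 ≤ s) (hst : s ≤ t) (hr : t - s < r) :
    ∀ᶠ n : ℕ in atTop, Real.exp (E.rate * ((((⌊t / (1 / ((n : ℝ) + 1))⌋₊ -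
      ⌊s / (1 / ((n : ℝ) + 1))⌋₊ : ℕ) : ℝ) + 1) * (1 / ((n : ℝ) + 1)))) ≤
      Real.exp (E.rate * r) := by
  have h1 := (tendsto_floor_sub_mul hs hst (h := fun n : ℕ => 1 / ((n : ℝ) + 1))
    (fun n => by positivity) tendsto_one_div_add_atTop_nhds_zero_nat).add
    (tendsto_one_div_add_atTop_nhds_zero_nat (𝕜 := ℝ))
  rw [add_zero] at h1
  filter_upwards [h1.eventually (eventually_le_nhds hr)] with n hn
  have := E.rate_pos
  rw [add_mul, one_mul]
  gcongr

theorem eventually_step_le : ∀ᶠ n : ℕ in atTop, 1 / ((n : ℝ) + 1) ≤ E.maxStep :=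
  (tendsto_one_div_add_atTop_nhds_zero_nat (𝕜 := ℝ)).eventually
    (eventually_le_nhds E.maxStep_pos)

theorem cauchySeq_approx {s t : ℝ} (hs : 0 ≤ s) (hst : s ≤ t) (x : X₂) :
    CauchySeq fun n : ℕ => E.approx (1 / ((n : ℝ) + 1)) t s (ι₁ (ι₂ x)) := by
  refine Metric.cauchySeq_iff.2 fun ε hε => ?_
  obtain ⟨δ, hδ, H⟩ := E.exists_norm_approx_sub_le x hs hst (show 0 < ε / 3 by positivity)
  obtain ⟨N, hN⟩ := eventually_atTop.1
    ((tendsto_one_div_add_atTop_nhds_zero_nat (𝕜 := ℝ)).eventually (eventually_lt_nhds hδ))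
  refine ⟨N, fun m hm n hn => ?_⟩
  -- both steps are compared with their common refinement
  have h1 := H _ (by positivity) (hN m hm) (n + 1) n.succ_pos
  have h2 := H _ (by positivity) (hN n hn) (m + 1) m.succ_pos
  have h3 : 1 / ((m : ℝ) + 1) / ((n + 1 : ℕ) : ℝ) = 1 / ((n : ℝ) + 1) / ((m + 1 : ℕ) : ℝ) := by
    push_cast; field_simp
  rw [h3, ← dist_eq_norm] at h1
  rw [← dist_eq_norm] at h2
  have := dist_triangle_left (E.approx (1 / ((m : ℝ) + 1)) t s (ι₁ (ι₂ x)))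
    (E.approx (1 / ((n : ℝ) + 1)) t s (ι₁ (ι₂ x)))
    (E.approx (1 / ((n : ℝ) + 1) / ((m + 1 : ℕ) : ℝ)) t s (ι₁ (ι₂ x)))
  linarith

/-- `S₀`, with restrictions `S₁` and `S₂` to `X₁` and `X₂`, is a propagator of the family
`E.gen`: an evolution family that satisfies a quantitative first order expansion
(`norm_expansion_le`), from which both evolution equations follow. In the expansion, `w` serves to
approximate `E.gen r z` by an element of the domain. The growth bound on `X₀` has constant one,
so that products of propagators of different families are stable. -/
structure IsPropagator (S₀ : ℝ → ℝ → X₀ →L[ℂ] X₀) (S₁ : ℝ → ℝ → X₁ →L[ℂ] X₁)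
    (S₂ : ℝ → ℝ → X₂ →L[ℂ] X₂) (M K : ℝ) : Prop where
  M_pos : 0 < M
  K_pos : 0 < K
  norm₀_le : ∀ s t, 0 ≤ s → s ≤ t → ‖S₀ t s‖ ≤ Real.exp (E.rate * (t - s))
  norm₁_le : ∀ s t, 0 ≤ s → s ≤ t → ‖S₁ t s‖ ≤ M * Real.exp (E.rate * (t - s))
  norm₂_le : ∀ s t, 0 ≤ s → s ≤ t → ‖S₂ t s‖ ≤ M * Real.exp (E.rate * (t - s))
  map₁ : ∀ s t x, 0 ≤ s → s ≤ t → ι₁ (S₁ t s x) = S₀ t s (ι₁ x)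
  map₂ : ∀ s t x, 0 ≤ s → s ≤ t → ι₂ (S₂ t s x) = S₁ t s (ι₂ x)
  self : ∀ s, 0 ≤ s → S₀ s s = ContinuousLinearMap.id ℂ X₀
  trans : ∀ s u t, 0 ≤ s → s ≤ u → u ≤ t → S₀ t s = S₀ t u ∘L S₀ u s
  norm_apply_sub_le : ∀ s t x, 0 ≤ s → s ≤ t →
    ‖S₀ t s (ι₁ x) - ι₁ x‖ ≤ (t - s) * (Real.exp (E.rate * (t - s)) * K * ‖x‖)
  norm_expansion_le : ∀ s t r δ η Λ z w, 0 ≤ s → s ≤ t → 0 < δ →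
    (∀ σ, s - δ ≤ σ → σ ≤ t → ‖E.gen σ - E.gen r‖ ≤ η) →
    Real.exp (E.rate * (t - s + δ)) ≤ Λ →
    ‖S₀ t s (ι₁ z) - ι₁ z - (t - s) • E.gen r z‖ ≤ (t - s) * (Λ ^ 3 * η * ‖z‖ +
      (Λ + 1) * ‖E.gen r z - ι₁ w‖ + Λ * (t - s) * ‖E.gen r w‖)

/-- The Euler approximations converge strongly to a propagator. -/
theorem exists_isPropagator [CompleteSpace X₀] (hX₁ : IsReflexiveSpace X₁)
    (hX₂ : IsReflexiveSpace X₂) (hι₁ : Function.Injective ι₁) (hd₁ : DenseRange ι₁)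
    (hι₂ : Function.Injective ι₂) (hd₂ : DenseRange ι₂) :
    ∃ S₀ S₁ S₂ M K, E.IsPropagator S₀ S₁ S₂ M K := by
  have hr := E.rate_pos
  let h : ℕ → ℝ := fun n => 1 / ((n : ℝ) + 1)
  have h0 : ∀ n, 0 < h n := fun n => by positivity
  have hlim : Tendsto h atTop (𝓝 0) := tendsto_one_div_add_atTop_nhds_zero_nat
  have hm := E.eventually_step_le
  let N : ℝ → ℝ → ℕ → ℕ := fun t s n => ⌊t / h n⌋₊ - ⌊s / h n⌋₊
  have hN : ∀ s t, 0 ≤ s → s ≤ t → Tendsto (fun n => (N t s n : ℝ) * h n) atTop (𝓝 (t - s)) :=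
    fun s t hs hst => tendsto_floor_sub_mul hs hst h0 hlim
  have hexp : ∀ s t, 0 ≤ s → s ≤ t →
      Tendsto (fun n => Real.exp ((N t s n : ℝ) * (E.rate * h n))) atTop
        (𝓝 (Real.exp (E.rate * (t - s)))) := fun s t hs hst =>
    (Real.continuous_exp.tendsto _).comp
      (((hN s t hs hst).const_mul E.rate).congr fun n => by ring)
  have hexp1 : ∀ s t, 0 ≤ s → s ≤ t → ∀ᶠ n in atTop,
      Real.exp ((N t s n : ℝ) * (E.rate * h n)) ≤ Real.exp E.rate * Real.exp (E.rate * (t - s)) :=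
    fun s t hs hst => (hexp s t hs hst).eventually (eventually_le_nhds
      ((lt_mul_iff_one_lt_left (Real.exp_pos _)).2 (Real.one_lt_exp_iff.2 hr)))
  have hdense : DenseRange fun x : X₂ => ι₁ (ι₂ x) := hd₁.comp hd₂ ι₁.continuous
  have hS₀ : ∀ t s : ℝ, ∃ S : X₀ →L[ℂ] X₀, 0 ≤ s → s ≤ t →
      ∀ x, Tendsto (fun n => E.approx (h n) t s x) atTop (𝓝 (S x)) := by
    intro t s
    by_cases hst : 0 ≤ s ∧ s ≤ t
    · obtain ⟨S, hS⟩ := exists_clm_tendsto_of_cauchySeq hdense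
        (F := fun n => E.approx (h n) t s)
        (by filter_upwards [hm, hexp1 s t hst.1 hst.2] with n hn hn'
            exact (E.norm_prod₀_le (h0 n) hn _ _).trans hn')
        (E.cauchySeq_approx hst.1 hst.2)
      exact ⟨S, fun _ _ => hS⟩
    · exact ⟨0, fun h1 h2 => absurd ⟨h1, h2⟩ hst⟩
  choose S₀ hS₀ using hS₀
  have hS₁ : ∀ t s : ℝ, ∃ S : X₁ →L[ℂ] X₁, 0 ≤ s → s ≤ t →
      (∀ x, ι₁ (S x) = S₀ t s (ι₁ x)) ∧
        ‖S‖ ≤ Real.exp E.rate * Real.exp (E.rate * (t - s)) := by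
    intro t s
    by_cases hst : 0 ≤ s ∧ s ≤ t
    · have hmaps : MapsWithBound ι₁ (fun x => (S₀ t s ∘L ι₁) x)
          (Real.exp E.rate * Real.exp (E.rate * (t - s))) := by
        intro x
        refine hX₁.exists_of_tendsto ι₁ (w := fun n => E.prod₁ (h n) ⌊s / h n⌋₊ (N t s n) x) ?_ ?_
        · filter_upwards [hm, hexp1 s t hst.1 hst.2] with n hn hn'
          exact ContinuousLinearMap.le_of_opNorm_le _
            ((E.norm_prod₁_le (h0 n) hn _ _).trans hn') x
        · refine (hS₀ t s hst.1 hst.2 (ι₁ x)).congr' ?_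
          filter_upwards [hm] with n hn
          exact (E.map_prod₁ (h0 n) hn _ _ x).symm
      obtain ⟨G, hG, hGn⟩ := hmaps.exists_clm hι₁ (by positivity)
      exact ⟨G, fun _ _ => ⟨hG, hGn⟩⟩
    · exact ⟨0, fun h1 h2 => absurd ⟨h1, h2⟩ hst⟩
  choose S₁ hS₁ using hS₁
  have hinj : Function.Injective (ι₁ ∘L ι₂) := fun x y hxy => hι₂ (hι₁ hxy)
  have hS₂ : ∀ t s : ℝ, ∃ S : X₂ →L[ℂ] X₂, 0 ≤ s → s ≤ t →
      (∀ x, ι₂ (S x) = S₁ t s (ι₂ x)) ∧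
        ‖S‖ ≤ Real.exp E.rate * Real.exp (E.rate * (t - s)) := by
    intro t s
    by_cases hst : 0 ≤ s ∧ s ≤ t
    · have hmaps : MapsWithBound (ι₁ ∘L ι₂) (fun x => (S₀ t s ∘L ι₁ ∘L ι₂) x)
          (Real.exp E.rate * Real.exp (E.rate * (t - s))) := by
        intro x
        refine hX₂.exists_of_tendsto (ι₁ ∘L ι₂)
          (w := fun n => E.prod₂ (h n) ⌊s / h n⌋₊ (N t s n) x) ?_ ?_
        · filter_upwards [hm, hexp1 s t hst.1 hst.2] with n hn hn'
          exact ContinuousLinearMap.le_of_opNorm_le _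
            ((E.norm_prod₂_le (h0 n) hn _ _).trans hn') x
        · refine (hS₀ t s hst.1 hst.2 (ι₁ (ι₂ x))).congr' ?_
          filter_upwards [hm] with n hn
          change _ = ι₁ (ι₂ _)
          rw [E.map_prod₂ (h0 n) hn, E.map_prod₁ (h0 n) hn]
          rfl
      obtain ⟨G, hG, hGn⟩ := hmaps.exists_clm hinj (by positivity)
      refine ⟨G, fun _ _ => ⟨fun x => hι₁ ?_, hGn⟩⟩
      rw [(hS₁ t s hst.1 hst.2).1]
      exact hG x
    · exact ⟨0, fun h1 h2 => absurd ⟨h1, h2⟩ hst⟩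
  choose S₂ hS₂ using hS₂
  obtain ⟨K, hK⟩ := E.bounded_gen
  have hK1 : ∀ t, ‖E.gen t‖ ≤ K + 1 := fun t => (hK t).trans (by linarith)
  have hK0 : 0 < K + 1 := by have := (norm_nonneg _).trans (hK 0); linarith
  refine ⟨S₀, S₁, S₂, Real.exp E.rate, K + 1,
    { M_pos := Real.exp_pos _
      K_pos := hK0
      norm₀_le := ?_
      norm₁_le := fun s t hs hst => (hS₁ t s hs hst).2
      norm₂_le := fun s t hs hst => (hS₂ t s hs hst).2
      map₁ := fun s t x hs hst => (hS₁ t s hs hst).1 x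
      map₂ := fun s t x hs hst => (hS₂ t s hs hst).1 x
      self := ?_
      trans := ?_
      norm_apply_sub_le := ?_
      norm_expansion_le := ?_ }⟩
  · intro s t hs hst
    refine ContinuousLinearMap.opNorm_le_bound _ (Real.exp_pos _).le fun x => ?_
    refine le_of_tendsto_of_tendsto (hS₀ t s hs hst x).norm ((hexp s t hs hst).mul_const ‖x‖) ?_
    filter_upwards [hm] with n hn
    exact ContinuousLinearMap.le_of_opNorm_le _ (E.norm_prod₀_le (h0 n) hn _ _) x
  · intro s hs
    ext x
    refine tendsto_nhds_unique (hS₀ s s hs le_rfl x) (tendsto_const_nhds.congr fun n => ?_)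
    simp [approx, prod₀, stepProd_zero]
  · intro s u t hs hsu hut
    ext x
    have hu : 0 ≤ u := hs.trans hsu
    refine tendsto_nhds_unique (hS₀ t s hs (hsu.trans hut) x) ?_
    change Tendsto _ _ (𝓝 (S₀ t u (S₀ u s x)))
    have h1 : Tendsto (fun n => E.approx (h n) t u (E.approx (h n) u s x - S₀ u s x)) atTop
        (𝓝 0) := by
      have h2 : Tendsto (fun n => Real.exp E.rate * Real.exp (E.rate * (t - u)) *
          ‖E.approx (h n) u s x - S₀ u s x‖) atTop (𝓝 0) := by
        have := ((hS₀ u s hs hsu x).sub_const (S₀ u s x)).norm.const_mul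
          (Real.exp E.rate * Real.exp (E.rate * (t - u)))
        simpa using this
      refine squeeze_zero_norm' ?_ h2
      filter_upwards [hm, hexp1 u t hu hut] with n hn hn'
      exact ContinuousLinearMap.le_of_opNorm_le _
        ((E.norm_prod₀_le (h0 n) hn _ _).trans hn') _
    have h3 := h1.add (hS₀ t u hu hut (S₀ u s x))
    rw [zero_add] at h3
    refine h3.congr fun n => ?_
    rw [map_sub, sub_add_cancel]
    have hn := h0 n
    exact (stepProd_trans_apply _ (Nat.floor_le_floor (by gcongr))
      (Nat.floor_le_floor (by gcongr)) x).symm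
  · intro s t x hs hst
    have hlimΛ : Tendsto (fun n => Real.exp (E.rate * ((N t s n + 1) * h n))) atTop
        (𝓝 (Real.exp (E.rate * (t - s)))) := by
      refine (Real.continuous_exp.tendsto _).comp (Tendsto.const_mul _ ?_)
      have := (hN s t hs hst).add hlim
      rw [add_zero] at this
      exact this.congr fun n => by ring
    refine le_of_tendsto_of_tendsto ((hS₀ t s hs hst (ι₁ x)).sub_const _).norm
      ((hN s t hs hst).mul ((hlimΛ.mul_const _).mul_const ‖x‖)) ?_
    filter_upwards [hm] with n hn
    exact E.norm_prod_sub_self_le (h0 n) hn hK1 le_rfl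
  · intro s t r δ η Λ z w hs hst hδ hη hΛ
    have hNn := hN s t hs hst
    refine le_of_tendsto_of_tendsto
      (((hS₀ t s hs hst (ι₁ z)).sub_const _).sub (hNn.smul_const (E.gen r z))).norm
      (hNn.mul (((tendsto_const_nhds (x := Λ ^ 3 * η * ‖z‖)).add
        (tendsto_const_nhds (x := (Λ + 1) * ‖E.gen r z - ι₁ w‖))).add
        ((hNn.const_mul Λ).mul_const ‖E.gen r w‖))) ?_
    filter_upwards [hm, E.eventually_exp_le hs hst (show t - s < t - s + δ by linarith),
      hlim.eventually (eventually_le_nhds hδ)] with n hn hn' hn''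
    have hn0 := h0 n
    refine E.norm_prod_sub_le (h0 n) hn (hn'.trans hΛ) (fun i hi => hη _ ?_ ?_)
      (E.step_apply _ r w (h0 n) hn)
    · have := (Nat.lt_floor_add_one (s / h n)).le
      rw [div_le_iff₀ hn0] at this
      push_cast
      have : 0 ≤ (i : ℝ) * h n := by positivity
      linarith
    · have a1 := Nat.floor_le (show 0 ≤ t / h n from div_nonneg (hs.trans hst) hn0.le)
      rw [le_div_iff₀ hn0] at a1
      refine le_trans ?_ a1
      gcongr
      have : i < ⌊t / h n⌋₊ - ⌊s / h n⌋₊ := hi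
      omega

end EulerScheme
end EulerPropagator

/-! ### Strong continuity and differentiability of propagators -/

section PropagatorProperties

variable {X₀ X₁ X₂ : Type*}
  [NormedAddCommGroup X₀] [NormedSpace ℂ X₀]
  [NormedAddCommGroup X₁] [NormedSpace ℂ X₁]
  [NormedAddCommGroup X₂] [NormedSpace ℂ X₂]

namespace EulerScheme

variable {ι₁ : X₁ →L[ℂ] X₀} {ι₂ : X₂ →L[ℂ] X₁} (E : EulerScheme ι₁ ι₂)

/-- Interpolation: `L_u` is bounded from `X₂` to `X₀` with an arbitrarily small constant, up to a
multiple of the norm of `X₀`, because `X₂` lies in the domain of `L_u²`. -/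
theorem exists_norm_gen_le (u : ℝ) {ε : ℝ} (hε : 0 < ε) :
    ∃ C, 0 ≤ C ∧ ∀ z : X₂, ‖E.gen u (ι₂ z)‖ ≤ ε * ‖z‖ + C * ‖ι₁ (ι₂ z)‖ := by
  have hr := E.rate_pos
  have hm0 := E.maxStep_pos
  set G := ‖E.genSq u‖
  have hG : 0 ≤ G := norm_nonneg _
  set h := min (min E.maxStep 1) (ε / (Real.exp E.rate * (G + 1)))
  have h0 : 0 < h := by positivity
  have hm : h ≤ E.maxStep := (min_le_left _ _).trans (min_le_left _ _)
  have h1 : h ≤ 1 := (min_le_left _ _).trans (min_le_right _ _)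
  have h2 : h * (Real.exp E.rate * (G + 1)) ≤ ε :=
    (le_div_iff₀ (by positivity)).1 (min_le_right _ _)
  refine ⟨h⁻¹ * (Real.exp E.rate + 1), by positivity, fun z => ?_⟩
  have hJ : ‖E.step₀ h u‖ ≤ Real.exp E.rate :=
    (E.norm_step₀_le h u h0 hm).trans (Real.exp_le_exp.2 (by nlinarith))
  have e1 := E.step_apply h u (ι₂ z) h0 hm
  rw [E.step_gen h u z h0 hm, smul_add] at e1
  have e2 : E.gen u (ι₂ z) = h⁻¹ • (E.step₀ h u (ι₁ (ι₂ z)) - ι₁ (ι₂ z)) -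
      h • E.step₀ h u (E.genSq u z) := by
    rw [e1, add_sub_cancel_left, smul_add, inv_smul_smul₀ h0.ne', inv_smul_smul₀ h0.ne',
      add_sub_cancel_right]
  have e3 : ‖E.step₀ h u (ι₁ (ι₂ z))‖ ≤ Real.exp E.rate * ‖ι₁ (ι₂ z)‖ :=
    ContinuousLinearMap.le_of_opNorm_le _ hJ _
  have e4 : ‖E.step₀ h u (E.genSq u z)‖ ≤ Real.exp E.rate * (G * ‖z‖) :=
    (ContinuousLinearMap.le_of_opNorm_le _ hJ _).trans (by
      gcongr; exact ContinuousLinearMap.le_opNorm _ _)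
  rw [e2]
  refine (norm_sub_le _ _).trans ?_
  rw [norm_smul, norm_smul, Real.norm_of_nonneg h0.le, Real.norm_of_nonneg (inv_pos.2 h0).le]
  have e5 := norm_sub_le (E.step₀ h u (ι₁ (ι₂ z))) (ι₁ (ι₂ z))
  calc _ ≤ h⁻¹ * (Real.exp E.rate * ‖ι₁ (ι₂ z)‖ + ‖ι₁ (ι₂ z)‖) +
        h * (Real.exp E.rate * (G * ‖z‖)) := by gcongr; exact e5.trans (by gcongr)
    _ = h * (Real.exp E.rate * G) * ‖z‖ + h⁻¹ * (Real.exp E.rate + 1) * ‖ι₁ (ι₂ z)‖ := by ring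
    _ ≤ _ := by
        gcongr
        refine le_trans ?_ h2
        gcongr
        linarith

theorem tendsto_gen_zero {α : Type*} {l : Filter α} {ξ : α → X₂} {B : ℝ} (u : ℝ)
    (hB : ∀ᶠ a in l, ‖ξ a‖ ≤ B) (hξ : Tendsto (fun a => ι₁ (ι₂ (ξ a))) l (𝓝 0)) :
    Tendsto (fun a => E.gen u (ι₂ (ξ a))) l (𝓝 0) := by
  rw [Metric.tendsto_nhds]
  intro ε hε
  obtain ⟨C, hC, H⟩ := E.exists_norm_gen_le u (show 0 < ε / (2 * (|B| + 1)) by positivity)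
  have h1 : Tendsto (fun a => C * ‖ι₁ (ι₂ (ξ a))‖) l (𝓝 0) := by
    simpa using hξ.norm.const_mul C
  filter_upwards [hB, h1.eventually (eventually_lt_nhds (half_pos hε))] with a ha ha'
  rw [dist_zero_right]
  have h2 : ε / (2 * (|B| + 1)) * ‖ξ a‖ ≤ ε / (2 * (|B| + 1)) * (|B| + 1) := by
    gcongr
    linarith [le_abs_self B]
  have h3 : ε / (2 * (|B| + 1)) * (|B| + 1) = ε / 2 := by field_simp
  linarith [H (ξ a)]

theorem exp_le {s t T : ℝ} (hs : 0 ≤ s) (hT : t ≤ T) :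
    Real.exp (E.rate * (t - s)) ≤ Real.exp (E.rate * T) := by
  have := E.rate_pos
  gcongr
  linarith

namespace IsPropagator

variable {E}
variable {S₀ : ℝ → ℝ → X₀ →L[ℂ] X₀} {S₁ : ℝ → ℝ → X₁ →L[ℂ] X₁} {S₂ : ℝ → ℝ → X₂ →L[ℂ] X₂}
  {M K : ℝ} (P : E.IsPropagator S₀ S₁ S₂ M K)

include P

theorem trans_apply {s u t : ℝ} (hs : 0 ≤ s) (hsu : s ≤ u) (hut : u ≤ t) (x : X₀) :
    S₀ t s x = S₀ t u (S₀ u s x) := by rw [P.trans s u t hs hsu hut]; rfl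

/-- The propagator is strongly continuous. -/
theorem continuousOn_simplex2 (hd₁ : DenseRange ι₁) (T : ℝ) (x : X₀) :
    ContinuousOn (fun p : ℝ × ℝ => S₀ p.1 p.2 x) (simplex2 T) := by
  set Λ := Real.exp (E.rate * T)
  have hΛ : 0 < Λ := Real.exp_pos _
  have hK := P.K_pos
  have hM := P.M_pos
  have key : ∀ x : X₁, ContinuousOn (fun p : ℝ × ℝ => S₀ p.1 p.2 (ι₁ x)) (simplex2 T) := by
    intro x
    set C₁ := Λ * K * (M * Λ * ‖x‖)
    set C₂ := Λ * (Λ * K * ‖x‖)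
    have left : ∀ s t t', 0 ≤ s → s ≤ t → t ≤ t' → t' ≤ T →
        ‖S₀ t' s (ι₁ x) - S₀ t s (ι₁ x)‖ ≤ (t' - t) * C₁ := by
      intro s t t' hs hst htt hT
      rw [P.trans_apply hs hst htt, ← P.map₁ s t x hs hst]
      refine (P.norm_apply_sub_le t t' _ (hs.trans hst) htt).trans ?_
      have h1 := E.exp_le (s := t) (t := t') (hs.trans hst) hT
      have h2 : ‖S₁ t s x‖ ≤ M * Λ * ‖x‖ := ContinuousLinearMap.le_of_opNorm_le _
        ((P.norm₁_le s t hs hst).trans (by gcongr; exact E.exp_le hs (htt.trans hT))) x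
      have : 0 ≤ t' - t := sub_nonneg.2 htt
      refine mul_le_mul_of_nonneg_left ?_ this
      exact mul_le_mul (by gcongr) h2 (norm_nonneg _) (by positivity)
    have right : ∀ s s' t, 0 ≤ s → s ≤ s' → s' ≤ t → t ≤ T →
        ‖S₀ t s (ι₁ x) - S₀ t s' (ι₁ x)‖ ≤ (s' - s) * C₂ := by
      intro s s' t hs hss hst hT
      rw [P.trans_apply hs hss hst, ← map_sub]
      have h1 := (P.norm₀_le s' t (hs.trans hss) hst).trans (E.exp_le (hs.trans hss) hT)
      refine (ContinuousLinearMap.le_of_opNorm_le _ h1 _).trans ?_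
      have h2 := P.norm_apply_sub_le s s' x hs hss
      have h3 := E.exp_le (s := s) (t := s') hs (hst.trans hT)
      have : 0 ≤ s' - s := sub_nonneg.2 hss
      calc _ ≤ Λ * ((s' - s) * (Λ * K * ‖x‖)) := by gcongr; exact h2.trans (by gcongr)
        _ = _ := by ring
    have left' : ∀ s t m, 0 ≤ s → s ≤ t → t ≤ m → m ≤ T →
        dist (S₀ t s (ι₁ x)) (S₀ m s (ι₁ x)) ≤ |m - t| * C₁ := by
      intro s t m hs hst htm hT
      rw [dist_comm, dist_eq_norm, abs_of_nonneg (sub_nonneg.2 htm)]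
      exact left s t m hs hst htm hT
    have right' : ∀ s s' t, 0 ≤ s → 0 ≤ s' → s ≤ t → s' ≤ t → t ≤ T →
        dist (S₀ t s (ι₁ x)) (S₀ t s' (ι₁ x)) ≤ |s - s'| * C₂ := by
      intro s s' t hs hs' hst hst' hT
      rcases le_total s s' with hss | hss
      · rw [dist_eq_norm, abs_sub_comm, abs_of_nonneg (sub_nonneg.2 hss)]
        exact right s s' t hs hss hst' hT
      · rw [dist_comm, dist_eq_norm, abs_of_nonneg (sub_nonneg.2 hss)]
        exact right s' s t hs' hss hst hT
    rintro ⟨t, s⟩ ⟨hs, hst, hT⟩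
    rw [ContinuousWithinAt, tendsto_iff_dist_tendsto_zero]
    have hlim : Tendsto (fun p : ℝ × ℝ => |max p.1 t - p.1| * C₁ + |p.2 - s| * C₂ +
        |max p.1 t - t| * C₁) (𝓝[simplex2 T] (t, s)) (𝓝 0) := by
      have : Continuous fun p : ℝ × ℝ => |max p.1 t - p.1| * C₁ + |p.2 - s| * C₂ +
        |max p.1 t - t| * C₁ := by fun_prop
      have h2 := this.tendsto (t, s)
      simp only [max_self, sub_self, abs_zero, zero_mul, add_zero] at h2
      exact h2.mono_left nhdsWithin_le_nhds
    refine squeeze_zero' (Eventually.of_forall fun _ => dist_nonneg) ?_ hlim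
    filter_upwards [self_mem_nhdsWithin] with p hp
    obtain ⟨hs', hst', hT'⟩ := hp
    -- both points are connected through the later of the two times
    refine (dist_triangle4 _ (S₀ (max p.1 t) p.2 (ι₁ x)) (S₀ (max p.1 t) s (ι₁ x)) _).trans
      (add_le_add_three ?_ ?_ ?_)
    · exact left' _ _ _ hs' hst' (le_max_left _ _) (max_le hT' hT)
    · exact right' _ _ _ hs' hs (hst'.trans (le_max_left _ _)) (hst.trans (le_max_right _ _))
        (max_le hT' hT)
    · rw [dist_comm]
      exact left' _ _ _ hs hst (le_max_right _ _) (max_le hT' hT)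
  refine continuousOn_of_uniform_approx_of_continuousOn fun U hU => ?_
  obtain ⟨ε, hε, hεU⟩ := Metric.mem_uniformity_dist.1 hU
  obtain ⟨y, hy⟩ := hd₁.exists_dist_lt x (show 0 < ε / Λ by positivity)
  refine ⟨_, key y, fun p hp => hεU ?_⟩
  rw [dist_eq_norm, ← map_sub]
  refine (ContinuousLinearMap.le_of_opNorm_le _
    ((P.norm₀_le _ _ hp.1 hp.2.1).trans (E.exp_le hp.1 hp.2.2)) _).trans_lt ?_
  rw [← dist_eq_norm]
  exact (lt_div_iff₀' hΛ).1 hy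

theorem continuousOn_left (hd₁ : DenseRange ι₁) {s : ℝ} (hs : 0 ≤ s) (T : ℝ) (x : X₀) :
    ContinuousOn (fun t => S₀ t s x) (Icc s T) :=
  (P.continuousOn_simplex2 hd₁ T x).comp (f := fun t => (t, s)) (by fun_prop)
    fun _ ht => ⟨hs, ht.1, ht.2⟩

theorem continuousOn_right (hd₁ : DenseRange ι₁) (t : ℝ) (x : X₀) :
    ContinuousOn (fun s => S₀ t s x) (Icc 0 t) :=
  (P.continuousOn_simplex2 hd₁ t x).comp (f := fun s => (t, s)) (by fun_prop)
    fun _ hs => ⟨hs.1, hs.2, le_rfl⟩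

/-- Trajectories starting in `X₁` are continuous in the graph norm of each operator of any
family with the same spaces. -/
theorem continuousOn_gen (hd₁ : DenseRange ι₁) (hd₂ : DenseRange ι₂) (E' : EulerScheme ι₁ ι₂)
    (r : ℝ) {s : ℝ} (hs : 0 ≤ s) (T : ℝ) (x : X₁) :
    ContinuousOn (fun u => E'.gen r (S₁ u s x)) (Icc s T) := by
  set Λ := Real.exp (E.rate * T)
  have hΛ : 0 < Λ := Real.exp_pos _
  have hM := P.M_pos
  have key : ∀ y : X₂, ContinuousOn (fun u => E'.gen r (S₁ u s (ι₂ y))) (Icc s T) := by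
    intro y u hu
    have h1 : Tendsto (fun v => E'.gen r (ι₂ (S₂ v s y - S₂ u s y))) (𝓝[Icc s T] u) (𝓝 0) := by
      have hb : ∀ v ∈ Icc s T, ‖S₂ v s y‖ ≤ M * Λ * ‖y‖ := fun v hv =>
        ContinuousLinearMap.le_of_opNorm_le _ ((P.norm₂_le s v hs hv.1).trans
          (by gcongr; exact E.exp_le hs hv.2)) y
      refine E'.tendsto_gen_zero (B := M * Λ * ‖y‖ + M * Λ * ‖y‖) r ?_ ?_
      · filter_upwards [self_mem_nhdsWithin] with v hv
        exact (norm_sub_le _ _).trans (add_le_add (hb v hv) (hb u hu))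
      · have h2 := (P.continuousOn_left hd₁ hs T (ι₁ (ι₂ y)) u hu).tendsto.sub_const
          (S₀ u s (ι₁ (ι₂ y)))
        rw [sub_self] at h2
        refine h2.congr' ?_
        filter_upwards [self_mem_nhdsWithin] with v hv
        rw [map_sub, map_sub, P.map₂ s v y hs hv.1, P.map₂ s u y hs hu.1, P.map₁ s v _ hs hv.1,
          P.map₁ s u _ hs hu.1]
    have h3 := h1.add_const (E'.gen r (S₁ u s (ι₂ y)))
    rw [zero_add] at h3
    refine h3.congr' ?_
    filter_upwards [self_mem_nhdsWithin] with v hv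
    rw [map_sub, map_sub, P.map₂ s v y hs hv.1, P.map₂ s u y hs hu.1, sub_add_cancel]
  refine continuousOn_of_uniform_approx_of_continuousOn fun U hU => ?_
  obtain ⟨ε, hε, hεU⟩ := Metric.mem_uniformity_dist.1 hU
  set C := (‖E'.gen r‖ + 1) * (M * Λ)
  have hC : 0 < C := by positivity
  obtain ⟨y, hy⟩ := hd₂.exists_dist_lt x (show 0 < ε / C by positivity)
  refine ⟨_, key y, fun u hu => hεU ?_⟩
  rw [dist_eq_norm, ← map_sub, ← map_sub]
  have h1 : ‖S₁ u s (x - ι₂ y)‖ ≤ M * Λ * ‖x - ι₂ y‖ := ContinuousLinearMap.le_of_opNorm_le _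
    ((P.norm₁_le s u hs hu.1).trans (by gcongr; exact E.exp_le hs hu.2)) _
  calc _ ≤ (‖E'.gen r‖ + 1) * (M * Λ * ‖x - ι₂ y‖) :=
        ((E'.gen r).le_of_opNorm_le (lt_add_one _).le _).trans (by gcongr)
    _ = C * dist x (ι₂ y) := by rw [dist_eq_norm]; ring
    _ < ε := (lt_div_iff₀' hC).1 hy

/-- Strict differentiability: `S_{v,u} z_u - z_u = (v - u) L_r z_r + o(v - u)` for
`u ≤ v` near `r`, for a curve `z` that is bounded in `X₁` and for which `L_r z_u` tends to `p`
(that is, to `L_r z_r`). -/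
theorem exists_norm_sub_le (hd₁ : DenseRange ι₁) {D : Set ℝ} {ζ : ℝ → X₁} {r B : ℝ} {p : X₀}
    (hB : ∀ u ∈ D, ‖ζ u‖ ≤ B) (hp : Tendsto (fun u => E.gen r (ζ u)) (𝓝[D] r) (𝓝 p))
    {ε : ℝ} (hε : 0 < ε) :
    ∃ δ > 0, ∀ u v, u ∈ D → |u - r| < δ → |v - r| < δ → 0 ≤ u → u ≤ v →
      ‖S₀ v u (ι₁ (ζ u)) - ι₁ (ζ u) - (v - u) • p‖ ≤ ε * (v - u) := by
  have hr := E.rate_pos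
  set Λ := Real.exp (E.rate * 3)
  have hΛ : 1 ≤ Λ := Real.one_le_exp (by positivity)
  set ε₁ := ε / (8 * (Λ + 1))
  have hε₁ : 0 < ε₁ := by positivity
  set η := ε / (4 * (Λ ^ 3 * (|B| + 1)))
  have hη : 0 < η := by positivity
  obtain ⟨δ₁, hδ₁, H₁⟩ := Metric.uniformContinuous_iff.1 E.uniformContinuous_gen η hη
  obtain ⟨w, hw⟩ := hd₁.exists_dist_lt p hε₁
  obtain ⟨δ₂, hδ₂, H₂⟩ := Metric.tendsto_nhdsWithin_nhds.1 hp ε₁ hε₁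
  set δ := min (min 1 (δ₁ / 2)) (min δ₂ (ε / (8 * Λ * (‖E.gen r w‖ + 1))))
  have hδ : 0 < δ := by positivity
  have d1 : δ ≤ 1 := (min_le_left _ _).trans (min_le_left _ _)
  have d2 : δ ≤ δ₁ / 2 := (min_le_left _ _).trans (min_le_right _ _)
  have d3 : δ ≤ δ₂ := (min_le_right _ _).trans (min_le_left _ _)
  have d4 : δ * (8 * Λ * (‖E.gen r w‖ + 1)) ≤ ε :=
    (le_div_iff₀ (by positivity)).1 ((min_le_right _ _).trans (min_le_right _ _))
  refine ⟨δ, hδ, fun u v huD hu hv hu0 huv => ?_⟩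
  have hu' := abs_lt.1 hu
  have hv' := abs_lt.1 hv
  have h1 := P.norm_expansion_le u v r δ η Λ (ζ u) w hu0 huv hδ
    (fun σ hσ hσ' => by
      rw [← dist_eq_norm]
      refine (H₁ ?_).le
      rw [Real.dist_eq, abs_lt]
      constructor <;> linarith)
    (Real.exp_le_exp.2 (by gcongr; linarith))
  have h2 : ‖E.gen r (ζ u) - p‖ < ε₁ := by
    rw [← dist_eq_norm]
    exact H₂ huD (by rw [Real.dist_eq]; linarith)
  rw [dist_eq_norm] at hw
  have h3 : ‖E.gen r (ζ u) - ι₁ w‖ ≤ 2 * ε₁ := by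
    have := norm_sub_le_norm_sub_add_norm_sub (E.gen r (ζ u)) p (ι₁ w)
    linarith
  have hvu : 0 ≤ v - u := sub_nonneg.2 huv
  have h4 : S₀ v u (ι₁ (ζ u)) - ι₁ (ζ u) - (v - u) • p =
      (S₀ v u (ι₁ (ζ u)) - ι₁ (ζ u) - (v - u) • E.gen r (ζ u)) +
        (v - u) • (E.gen r (ζ u) - p) := by rw [smul_sub]; abel
  rw [h4]
  refine (norm_add_le _ _).trans ?_
  rw [norm_smul, Real.norm_of_nonneg hvu]
  have q1 : Λ ^ 3 * η * ‖ζ u‖ ≤ ε / 4 := by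
    have : Λ ^ 3 * η * ‖ζ u‖ ≤ Λ ^ 3 * η * (|B| + 1) := by
      gcongr
      linarith [hB u huD, le_abs_self B]
    refine this.trans_eq ?_
    simp only [η]
    field_simp
  have q2 : (Λ + 1) * ‖E.gen r (ζ u) - ι₁ w‖ ≤ ε / 4 := by
    have : (Λ + 1) * ‖E.gen r (ζ u) - ι₁ w‖ ≤ (Λ + 1) * (2 * ε₁) := by gcongr
    refine this.trans_eq ?_
    simp only [ε₁]
    field_simp
    norm_num
  have q3 : Λ * (v - u) * ‖E.gen r w‖ ≤ ε / 4 := by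
    have : Λ * (v - u) * ‖E.gen r w‖ ≤ Λ * (2 * δ) * (‖E.gen r w‖ + 1) := by
      gcongr <;> linarith
    linarith
  have q4 : ε₁ ≤ ε / 4 := by
    simp only [ε₁]
    gcongr
    linarith
  calc _ ≤ (v - u) * (ε / 4 + ε / 4 + ε / 4) + (v - u) * (ε / 4) := by
        refine add_le_add (h1.trans (by gcongr)) ?_
        gcongr
        linarith
    _ = _ := by ring

theorem hasDerivWithinAt_left (hd₁ : DenseRange ι₁) (hd₂ : DenseRange ι₂) {s t T : ℝ}
    (hs : 0 ≤ s) (hst : s ≤ t) (htT : t ≤ T) (x : X₁) :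
    HasDerivWithinAt (fun τ => S₀ τ s (ι₁ x)) (E.gen t (S₁ t s x)) (Icc s T) t := by
  rw [hasDerivWithinAt_iff_isLittleO, Asymptotics.isLittleO_iff]
  intro ε hε
  obtain ⟨δ, hδ, H⟩ := P.exists_norm_sub_le hd₁ (D := Icc s T) (ζ := fun u => S₁ u s x) (r := t)
    (B := M * Real.exp (E.rate * T) * ‖x‖)
    (fun u hu => ContinuousLinearMap.le_of_opNorm_le _ ((P.norm₁_le s u hs hu.1).trans
      (mul_le_mul_of_nonneg_left (E.exp_le hs hu.2) P.M_pos.le)) x)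
    (P.continuousOn_gen hd₁ hd₂ E t hs T x t ⟨hst, htT⟩) hε
  filter_upwards [self_mem_nhdsWithin, mem_nhdsWithin_of_mem_nhds (Metric.ball_mem_nhds t hδ)]
    with τ hτ hτδ
  rw [Metric.mem_ball, Real.dist_eq] at hτδ
  have ht0 : |t - t| < δ := by simpa using hδ
  rcases le_total t τ with h | h
  · have h1 := H t τ ⟨hst, htT⟩ ht0 hτδ (hs.trans hst) h
    rw [P.map₁ s t x hs hst, ← P.trans_apply hs hst h] at h1
    rwa [Real.norm_of_nonneg (sub_nonneg.2 h)]
  · have h1 := H τ t hτ hτδ ht0 (hs.trans hτ.1) h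
    rw [P.map₁ s τ x hs hτ.1, ← P.trans_apply hs hτ.1 h] at h1
    rw [norm_sub_rev τ t, Real.norm_of_nonneg (sub_nonneg.2 h), ← norm_neg]
    have h2 : -(S₀ τ s (ι₁ x) - S₀ t s (ι₁ x) - (τ - t) • E.gen t (S₁ t s x)) =
        S₀ t s (ι₁ x) - S₀ τ s (ι₁ x) - (t - τ) • E.gen t (S₁ t s x) := by
      rw [← neg_sub τ t, neg_smul]
      abel
    rwa [h2]

theorem hasDerivWithinAt_right (hd₁ : DenseRange ι₁) {s t : ℝ} (hs : 0 ≤ s) (hst : s ≤ t)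
    (x : X₁) :
    HasDerivWithinAt (fun σ => S₀ t σ (ι₁ x)) (-(S₀ t s (E.gen s x))) (Icc 0 t) s := by
  rw [hasDerivWithinAt_iff_isLittleO, Asymptotics.isLittleO_iff]
  intro ε hε
  set Λ := Real.exp (E.rate * t)
  have hΛ : 0 < Λ := Real.exp_pos _
  obtain ⟨δ, hδ, H⟩ := P.exists_norm_sub_le hd₁ (D := univ) (ζ := fun _ => x) (r := s)
    (B := ‖x‖) (p := E.gen s x) (fun u _ => le_rfl) tendsto_const_nhds
    (show 0 < ε / (2 * Λ) by positivity)
  have hcont := (P.continuousOn_right hd₁ t (E.gen s x) s ⟨hs, hst⟩).tendsto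
  filter_upwards [self_mem_nhdsWithin, mem_nhdsWithin_of_mem_nhds (Metric.ball_mem_nhds s hδ),
    Metric.tendsto_nhds.1 hcont (ε / 2) (half_pos hε)] with σ hσ hσδ hσc
  rw [Metric.mem_ball, Real.dist_eq] at hσδ
  rw [dist_eq_norm] at hσc
  have hs0 : |s - s| < δ := by simpa using hδ
  have hb : ∀ u, 0 ≤ u → u ≤ t → ∀ y : X₀, ‖S₀ t u y‖ ≤ Λ * ‖y‖ := fun u hu hut y =>
    ContinuousLinearMap.le_of_opNorm_le _ ((P.norm₀_le u t hu hut).trans (E.exp_le hu le_rfl)) y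
  have hhalf : Λ * (ε / (2 * Λ)) = ε / 2 := by field_simp
  rcases le_total s σ with h | h
  · have h1 := H s σ (mem_univ _) hs0 hσδ hs h
    have h2 : S₀ t σ (ι₁ x) - S₀ t s (ι₁ x) - (σ - s) • -(S₀ t s (E.gen s x)) =
        -(S₀ t σ (S₀ σ s (ι₁ x) - ι₁ x - (σ - s) • E.gen s x)) -
          (σ - s) • (S₀ t σ (E.gen s x) - S₀ t s (E.gen s x)) := by
      rw [P.trans_apply hs h hσ.2 (ι₁ x), map_sub, map_sub,
        ContinuousLinearMap.map_smul_of_tower, smul_sub, smul_neg]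
      abel
    have hσs : 0 ≤ σ - s := sub_nonneg.2 h
    rw [h2, Real.norm_of_nonneg hσs]
    refine (norm_sub_le _ _).trans ?_
    rw [norm_neg, norm_smul, Real.norm_of_nonneg hσs]
    calc _ ≤ Λ * (ε / (2 * Λ) * (σ - s)) + (σ - s) * (ε / 2) := by
          gcongr
          exact (hb σ hσ.1 hσ.2 _).trans (by gcongr)
      _ = ε * (σ - s) := by rw [← mul_assoc, hhalf]; ring
  · have h1 := H σ s (mem_univ _) hσδ hs0 hσ.1 h
    have hσs : 0 ≤ s - σ := sub_nonneg.2 h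
    have h2 : S₀ t σ (ι₁ x) - S₀ t s (ι₁ x) - (σ - s) • -(S₀ t s (E.gen s x)) =
        S₀ t s (S₀ s σ (ι₁ x) - ι₁ x - (s - σ) • E.gen s x) := by
      rw [P.trans_apply hσ.1 h hst (ι₁ x), map_sub, map_sub,
        ContinuousLinearMap.map_smul_of_tower, ← neg_sub s σ, smul_neg, neg_smul, neg_neg]
    rw [h2, norm_sub_rev σ s, Real.norm_of_nonneg hσs]
    calc _ ≤ Λ * (ε / (2 * Λ) * (s - σ)) := (hb s hs hst _).trans (by gcongr)
      _ = ε / 2 * (s - σ) := by rw [← mul_assoc, hhalf]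
      _ ≤ ε * (s - σ) := by gcongr; linarith

end IsPropagator

end EulerScheme
end PropagatorProperties

/-! ### Admissible families and quasipropagators -/

section Admissible

variable {X₀ X₁ X₂ : Type*}
  [NormedAddCommGroup X₀] [NormedSpace ℂ X₀]
  [NormedAddCommGroup X₁] [NormedSpace ℂ X₁]
  [NormedAddCommGroup X₂] [NormedSpace ℂ X₂]
  {ι₁ : X₁ →L[ℂ] X₀} {ι₂ : X₂ →L[ℂ] X₁}

/-- The Euler step `(1 - h L)⁻¹ = h⁻¹ (h⁻¹ - L)⁻¹` obtained from the resolvent at `h⁻¹`. -/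
theorem ResolventBound.exists_step {L : X₀ →ₗ.[ℂ] X₀} {h c : ℝ} (h0 : 0 < h) (hc : 0 ≤ c)
    (hι₁ : Function.Injective ι₁) (hι₂ : Function.Injective ι₂)
    (hR : ResolventBound ι₁ ι₂ L ((h⁻¹ : ℝ) : ℂ) (h * c)) :
    ∃ J₀ : X₀ →L[ℂ] X₀, ∃ J₁ : X₁ →L[ℂ] X₁, ∃ J₂ : X₂ →L[ℂ] X₂,
      ‖J₀‖ ≤ c ∧ ‖J₁‖ ≤ c ∧ ‖J₂‖ ≤ c ∧ (∀ x, ι₁ (J₁ x) = J₀ (ι₁ x)) ∧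
      (∀ x, ι₂ (J₂ x) = J₁ (ι₂ x)) ∧
      (∀ x : L.domain, J₀ x = x + h • J₀ (L x)) ∧
      ∀ y, ∃ hy : J₀ y ∈ L.domain, J₀ y - h • L ⟨J₀ y, hy⟩ = y := by
  obtain ⟨R, ⟨hR₁, hR₂⟩, hRn, hRX₁, hRX₂⟩ := hR
  have hi : 0 < h⁻¹ := inv_pos.2 h0
  have hcancel : h⁻¹ * (h * c) = c := by field_simp
  have m₁ := hRX₁.smul hi.le
  have m₂ := hRX₂.smul hi.le
  rw [hcancel] at m₁ m₂
  obtain ⟨J₁, hJ₁, hJ₁n⟩ := MapsWithBound.exists_clm (F := h⁻¹ • (R ∘L ι₁)) hι₁ m₁ hc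
  obtain ⟨J₂, hJ₂, hJ₂n⟩ := MapsWithBound.exists_clm (k := ι₁ ∘L ι₂)
    (F := h⁻¹ • (R ∘L ι₁ ∘L ι₂)) (fun x y hxy => hι₂ (hι₁ hxy)) m₂ hc
  refine ⟨h⁻¹ • R, J₁, J₂, ?_, hJ₁n, hJ₂n, hJ₁, fun x => hι₁ ?_, fun x => ?_, fun y => ?_⟩
  · rw [norm_smul, Real.norm_of_nonneg hi.le]
    calc h⁻¹ * ‖R‖ ≤ h⁻¹ * (h * c) := by gcongr
      _ = c := by field_simp
  · rw [hJ₁]; exact hJ₂ x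
  · have h1 := hR₂ x
    rw [map_sub, Complex.coe_smul, ContinuousLinearMap.map_smul_of_tower, sub_eq_iff_eq_add] at h1
    rw [smul_apply, smul_apply, h1, smul_inv_smul₀ h0.ne']
  · obtain ⟨hy, h1⟩ := hR₁ y
    have hdom : h⁻¹ • R y ∈ L.domain := by
      rw [← Complex.coe_smul]
      exact L.domain.smul_mem _ hy
    refine ⟨hdom, ?_⟩
    have h2 : L ⟨h⁻¹ • R y, hdom⟩ = h⁻¹ • L ⟨R y, hy⟩ := by
      have h3 := L.map_smul ((h⁻¹ : ℝ) : ℂ) ⟨R y, hy⟩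
      rw [Complex.coe_smul] at h3
      exact h3
    change h⁻¹ • R y - h • L ⟨h⁻¹ • R y, hdom⟩ = y
    rw [h2, smul_inv_smul₀ h0.ne', ← Complex.coe_smul]
    exact h1

/-- For small `h`, the resolvent bound at `h⁻¹` gives Euler steps of norm at most `exp (c h)`, with
`c = 2 |lam| + 1`. -/
theorem inv_inv_sub_le {h lam : ℝ} (h0 : 0 < h) (hh : h * (2 * (|lam| + 1)) ≤ 1) :
    lam < h⁻¹ ∧ (h⁻¹ - lam)⁻¹ ≤ h * Real.exp ((2 * |lam| + 1) * h) := by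
  have hl := abs_nonneg lam
  have h1 := le_abs_self lam
  have hy : 0 ≤ h * |lam| := by positivity
  have hpos : 0 < 1 - h * lam := by nlinarith
  have e1 : h⁻¹ - lam = h⁻¹ * (1 - h * lam) := by field_simp
  refine ⟨by rw [← sub_pos, e1]; positivity, ?_⟩
  rw [e1, mul_inv, inv_inv]
  gcongr
  rw [inv_le_iff_one_le_mul₀ hpos]
  have e2 := Real.add_one_le_exp ((2 * |lam| + 1) * h)
  have e3 : 1 - h * |lam| ≤ 1 - h * lam := by nlinarith
  calc (1 : ℝ) ≤ ((2 * |lam| + 1) * h + 1) * (1 - h * |lam|) := by nlinarith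
    _ ≤ _ := mul_le_mul e2 e3 (by nlinarith) (Real.exp_pos _).le

/-- A power of a control vanishes as the end points of the interval merge. The maximum and the
minimum serve to put the two times in order. -/
theorem IsControl.tendsto_rpow {T : ℝ} {ω : ℝ → ℝ → ℝ} (hω : IsControl T ω) {ϱ : ℝ} (hϱ : 0 < ϱ)
    {r : ℝ} (hr : r ∈ Icc 0 T) :
    Tendsto (fun t => ω (max t r) (min t r) ^ ϱ) (𝓝[Icc 0 T] r) (𝓝 0) := by
  have h1 : ContinuousOn (fun t => ω (max t r) (min t r)) (Icc 0 T) :=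
    hω.continuousOn.comp (f := fun t => (max t r, min t r)) (by fun_prop) fun t ht =>
      ⟨le_min ht.1 hr.1, min_le_max, max_le ht.2 hr.2⟩
  have h2 := (h1 r hr).tendsto
  simp only [max_self, min_self, hω.diag r hr.1 hr.2] at h2
  have h3 := h2.rpow_const (p := ϱ) (Or.inr hϱ.le)
  rwa [Real.zero_rpow hϱ.ne'] at h3

/-- An admissible family, extended by constants beyond `[0, T]`, has a backward Euler scheme. -/
theorem IsAdmissibleFamily.exists_eulerScheme [CompleteSpace X₀] [CompleteSpace X₁]
    [CompleteSpace X₂] {T : ℝ} (hT : 0 ≤ T) {L : ℝ → X₀ →ₗ.[ℂ] X₀}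
    (hι₁ : Function.Injective ι₁) (hι₂ : Function.Injective ι₂)
    (hL : IsAdmissibleFamily T ι₁ ι₂ L) :
    ∃ E : EulerScheme ι₁ ι₂, ∀ t (ht : t ∈ Icc 0 T) x,
      E.gen t x = L t ⟨ι₁ x, hL.dom₁ t ht x⟩ := by
  have hg : ∀ t : Icc 0 T, ∃ g : X₁ →L[ℂ] X₀, ∀ x, g x = L t ⟨ι₁ x, hL.dom₁ t t.2 x⟩ :=
    fun t => (hL.closed t t.2).exists_comp_eq ι₁ (hL.dom₁ t t.2)
  choose g hg using hg
  have hgd : ∀ (t : Icc 0 T) x, g t (ι₂ x) ∈ (L t).domain := fun t x => by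
    rw [hg]; exact hL.dom₂ t t.2 x
  have hq : ∀ t : Icc 0 T, ∃ q : X₂ →L[ℂ] X₀, ∀ x, q x = L t ⟨g t (ι₂ x), hgd t x⟩ :=
    fun t => (hL.closed t t.2).exists_comp_eq (g t ∘L ι₂) (hgd t)
  choose q hq using hq
  have hcont : Continuous g := by
    obtain ⟨ω, hω, ϱ, hϱ, hvar⟩ := hL.variation₀
    have hle : ∀ s t : Icc 0 T, s ≤ t → ‖g t - g s‖ ≤ ω t s ^ ϱ := fun s t hst =>
      ContinuousLinearMap.opNorm_le_bound _
        (Real.rpow_nonneg (hω.nonneg s t s.2.1 hst t.2.2) _) fun x => by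
          rw [sub_apply, hg, hg]
          exact hvar s t s.2 t.2 hst x
    refine continuous_iff_continuousAt.2 fun r => ?_
    rw [ContinuousAt, tendsto_iff_norm_sub_tendsto_zero]
    have h1 := (hω.tendsto_rpow hϱ.1 r.2).comp
      (tendsto_nhdsWithin_iff.2 ⟨(continuous_subtype_val (p := (· ∈ Icc 0 T))).tendsto r,
        Eventually.of_forall fun t => t.2⟩)
    refine squeeze_zero (fun _ => norm_nonneg _) (fun t => ?_) h1
    rcases le_total t r with h | h
    · have h' : (t : ℝ) ≤ r := h
      rw [norm_sub_rev]
      simpa [max_eq_right h', min_eq_left h'] using hle t r h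
    · have h' : (r : ℝ) ≤ t := h
      simpa [max_eq_left h', min_eq_right h'] using hle r t h
  obtain ⟨θ, -, lam, Λ, -, hres⟩ := hL.sectorial
  have hJ : ∀ (h : ℝ) (t : Icc 0 T), ∃ J₀ : X₀ →L[ℂ] X₀, ∃ J₁ : X₁ →L[ℂ] X₁,
      ∃ J₂ : X₂ →L[ℂ] X₂, 0 < h → h ≤ 1 / (2 * (|lam| + 1)) →
      ‖J₀‖ ≤ Real.exp ((2 * |lam| + 1) * h) ∧ ‖J₁‖ ≤ Real.exp ((2 * |lam| + 1) * h) ∧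
      ‖J₂‖ ≤ Real.exp ((2 * |lam| + 1) * h) ∧ (∀ x, ι₁ (J₁ x) = J₀ (ι₁ x)) ∧
      (∀ x, ι₂ (J₂ x) = J₁ (ι₂ x)) ∧
      (∀ x : (L t).domain, J₀ x = x + h • J₀ (L t x)) ∧
      ∀ y, ∃ hy : J₀ y ∈ (L t).domain, J₀ y - h • L t ⟨J₀ y, hy⟩ = y := by
    intro h t
    by_cases hh : 0 < h ∧ h ≤ 1 / (2 * (|lam| + 1))
    · obtain ⟨h1, h2⟩ := inv_inv_sub_le hh.1 ((le_div_iff₀ (by positivity)).1 hh.2)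
      obtain ⟨R, hR, hRn, hR₁, hR₂⟩ := (hres t t.2).2 h⁻¹ h1
      obtain ⟨J₀, J₁, J₂, H⟩ := ResolventBound.exists_step hh.1 (Real.exp_pos _).le hι₁ hι₂
        ⟨R, hR, hRn.trans h2, hR₁.mono h2, hR₂.mono h2⟩
      exact ⟨J₀, J₁, J₂, fun _ _ => H⟩
    · exact ⟨0, 0, 0, fun h1 h2 => absurd ⟨h1, h2⟩ hh⟩
  choose J₀ J₁ J₂ hJ using hJ
  let p : ℝ → Icc 0 T := projIcc 0 T hT
  have happly : ∀ (h : ℝ) (t : Icc 0 T), 0 < h → h ≤ 1 / (2 * (|lam| + 1)) →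
      ∀ x : (L t).domain, J₀ h t x = x + h • J₀ h t (L t x) :=
    fun h t h0 hm => (hJ h t h0 hm).2.2.2.2.2.1
  refine ⟨{
    gen := fun t => g (p t)
    genSq := fun t => q (p t)
    rate := 2 * |lam| + 1
    rate_pos := by positivity
    maxStep := 1 / (2 * (|lam| + 1))
    maxStep_pos := by positivity
    step₀ := fun h t => J₀ h (p t)
    step₁ := fun h t => J₁ h (p t)
    step₂ := fun h t => J₂ h (p t)
    norm_step₀_le := fun h t h0 hm => (hJ h (p t) h0 hm).1
    norm_step₁_le := fun h t h0 hm => (hJ h (p t) h0 hm).2.1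
    norm_step₂_le := fun h t h0 hm => (hJ h (p t) h0 hm).2.2.1
    map_step₁ := fun h t x h0 hm => (hJ h (p t) h0 hm).2.2.2.1 x
    map_step₂ := fun h t x h0 hm => (hJ h (p t) h0 hm).2.2.2.2.1 x
    step_apply := fun h t x h0 hm => by
      rw [hg]; exact happly h (p t) h0 hm ⟨ι₁ x, _⟩
    step_left := fun h t x h0 hm => by
      obtain ⟨hy, h1⟩ := (hJ h (p t) h0 hm).2.2.2.2.2.2 (ι₁ x)
      rw [hg]
      simpa only [(hJ h (p t) h0 hm).2.2.2.1 x] using h1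
    step_gen := fun h t x h0 hm => by
      rw [hq]; exact happly h (p t) h0 hm ⟨g (p t) (ι₂ x), hgd _ _⟩
    uniformContinuous_gen := (CompactSpace.uniformContinuous_of_continuous hcont).comp
      (LipschitzWith.projIcc hT).uniformContinuous
    bounded_gen := by
      obtain ⟨K, hK⟩ := (isCompact_range hcont).isBounded.exists_norm_le
      exact ⟨K, fun t => hK _ (mem_range_self _)⟩ }, ?_⟩
  intro t ht x
  have hp : p t = ⟨t, ht⟩ := projIcc_of_mem hT ht
  change g (p t) x = _
  rw [hp, hg]

/-- A propagator of the Euler scheme is a quasipropagator of the family. -/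
theorem EulerScheme.IsPropagator.isQuasipropagator {E : EulerScheme ι₁ ι₂}
    {S₀ : ℝ → ℝ → X₀ →L[ℂ] X₀} {S₁ : ℝ → ℝ → X₁ →L[ℂ] X₁} {S₂ : ℝ → ℝ → X₂ →L[ℂ] X₂} {M K : ℝ}
    (P : E.IsPropagator S₀ S₁ S₂ M K) (hd₁ : DenseRange ι₁) (hd₂ : DenseRange ι₂)
    {T : ℝ} {L : ℝ → X₀ →ₗ.[ℂ] X₀}
    (hL : ∀ t ∈ Icc 0 T, ∀ x, ∃ hx : ι₁ x ∈ (L t).domain, L t ⟨ι₁ x, hx⟩ = E.gen t x) :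
    IsQuasipropagator T ι₁ L S₀ where
  continuousOn := P.continuousOn_simplex2 hd₁ T
  growth := by
    refine ⟨E.rate, E.rate_pos, M + 1, by linarith [P.M_pos], fun s t hs hst htT => ⟨?_, ?_⟩⟩
    · have := Real.exp_pos (E.rate * (t - s))
      nlinarith [P.norm₀_le s t hs hst, P.M_pos]
    · intro x
      refine ⟨S₁ t s x, P.map₁ s t x hs hst, ContinuousLinearMap.le_of_opNorm_le _
        ((P.norm₁_le s t hs hst).trans ?_) x⟩
      gcongr
      linarith
  diag := fun s hs _ => P.self s hs
  mul := fun s u t hs hsu hut _ => P.trans s u t hs hsu hut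
  lipschitz := by
    have hK := P.K_pos
    refine ⟨Real.exp (E.rate * T) * K, by positivity, fun s t hs hst htT x => ?_⟩
    refine (P.norm_apply_sub_le s t x hs hst.le).trans ?_
    have h1 := E.exp_le hs htT
    have h2 : 0 ≤ t - s := sub_nonneg.2 hst.le
    calc _ ≤ (t - s) * (Real.exp (E.rate * T) * K * ‖x‖) := by gcongr
      _ = _ := by ring
  deriv_left := by
    intro s t hs hst htT x
    obtain ⟨h, h1⟩ := hL t ⟨hs.trans hst, htT⟩ (S₁ t s x)
    have h2 := P.hasDerivWithinAt_left hd₁ hd₂ hs hst htT x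
    rw [← h1] at h2
    simp only [P.map₁ s t x hs hst] at h h2
    exact ⟨h, h2⟩
  deriv_right := by
    intro s t hs hst htT x
    obtain ⟨h, h1⟩ := hL s ⟨hs, hst.trans htT⟩ x
    have h2 := P.hasDerivWithinAt_right hd₁ hs hst x
    rw [← h1] at h2
    exact ⟨h, h2⟩

/-- Quasipropagators are unique: `u ↦ S t u (S' u s x)` is constant for two of them. -/
theorem IsQuasipropagator.eq {T : ℝ} {L : ℝ → X₀ →ₗ.[ℂ] X₀} {S S' : ℝ → ℝ → X₀ →L[ℂ] X₀}
    (h : IsQuasipropagator T ι₁ L S) (h' : IsQuasipropagator T ι₁ L S') (hd₁ : DenseRange ι₁)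
    {s t : ℝ} (hs : 0 ≤ s) (hst : s ≤ t) (htT : t ≤ T) : S t s = S' t s := by
  have key : ∀ x : X₁, S t s (ι₁ x) = S' t s (ι₁ x) := by
    intro x
    obtain ⟨lam, hlam, Λ, hΛ, hgr⟩ := h.growth
    obtain ⟨lam', hlam', Λ', hΛ', hgr'⟩ := h'.growth
    have hderiv : ∀ u ∈ Icc s t,
        HasDerivWithinAt (fun u => S t u (S' u s (ι₁ x))) 0 (Icc s t) u := by
      intro u hu
      have hu0 : 0 ≤ u := hs.trans hu.1
      obtain ⟨w, hw, -⟩ := (hgr' s u hs hu.1 (hu.2.trans htT)).2 x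
      obtain ⟨d1, h1⟩ := h'.deriv_left s u hs hu.1 (hu.2.trans htT) x
      obtain ⟨d2, h2⟩ := h.deriv_right u t hu0 hu.2 htT w
      have hw' : ι₁ w = S' u s (ι₁ x) := hw
      simp only [hw'] at d2 h2
      have hc := (h.continuousOn (L u ⟨S' u s (ι₁ x), d1⟩)).comp (f := fun σ => (t, σ))
        (s := Icc s t) (by fun_prop) (fun σ hσ => ⟨hs.trans hσ.1, hσ.2, htT⟩)
      have h3 := hasDerivWithinAt_clm_apply_of_bounded (G := fun σ => S t σ)
        (y := fun σ => S' σ s (ι₁ x)) (D := Icc s t) (M := Λ * Real.exp (lam * T))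
        (fun σ hσ => ((hgr σ t (hs.trans hσ.1) hσ.2 htT).1).trans (by
          gcongr; linarith [hσ.1]))
        (hc u hu) (h1.mono (Icc_subset_Icc_right htT)) (h2.mono (Icc_subset_Icc_left hs))
      rwa [add_neg_cancel] at h3
    have hconst := constant_of_derivWithin_zero (fun u hu => (hderiv u hu).differentiableWithinAt)
      (fun u hu => by
        have hlt : s < t := hu.1.trans_lt hu.2
        exact (hderiv u ⟨hu.1, hu.2.le⟩).derivWithin (uniqueDiffOn_Icc hlt u ⟨hu.1, hu.2.le⟩))
      t ⟨hst, le_rfl⟩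
    rw [h.diag t (hs.trans hst) htT, h'.diag s hs (hst.trans htT)] at hconst
    exact hconst.symm
  exact ContinuousLinearMap.ext fun x => hd₁.induction_on (p := fun x => S t s x = S' t s x) x
    (isClosed_eq (S t s).continuous (S' t s).continuous) key

end Admissible

/-! ### Convergence of the product formula -/

namespace IntervalPartition

variable {s t : ℝ} (Q : IntervalPartition s t)

theorem node_le_node {i j : ℕ} (hij : i ≤ j) (hj : j ≤ Q.size) : Q.node i ≤ Q.node j := by
  induction j, hij using Nat.le_induction with
  | base => exact le_rfl
  | succ j _ ih => exact (ih (by omega)).trans (Q.node_lt j (by omega)).le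

theorem le_node {i : ℕ} (hi : i ≤ Q.size) : s ≤ Q.node i := by
  have := Q.node_le_node (Nat.zero_le i) hi
  rwa [Q.node_zero] at this

theorem node_le {i : ℕ} (hi : i ≤ Q.size) : Q.node i ≤ t := by
  have := Q.node_le_node hi le_rfl
  rwa [Q.node_size] at this

theorem sub_le_mesh {i : ℕ} (hi : i < Q.size) : Q.node (i + 1) - Q.node i ≤ Q.mesh :=
  le_ciSup (f := fun i : Fin Q.size => Q.node ((i : ℕ) + 1) - Q.node (i : ℕ))
    (Set.finite_range _).bddAbove ⟨i, hi⟩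

theorem sum_sub : ∑ i ∈ Finset.range Q.size, (Q.node (i + 1) - Q.node i) = t - s := by
  rw [Finset.sum_range_sub, Q.node_size, Q.node_zero]

end IntervalPartition

/-- Strong convergence of a bounded sequence of operators follows from convergence on a dense
set. -/
theorem tendsto_clm_of_denseRange {X V : Type*} [NormedAddCommGroup X] [NormedSpace ℂ X]
    {j : V → X} (hj : DenseRange j) {F : ℕ → X →L[ℂ] X} {S : X →L[ℂ] X} {M : ℝ}
    (hM : ∀ n, ‖F n‖ ≤ M) (hF : ∀ v, Tendsto (fun n => F n (j v)) atTop (𝓝 (S (j v)))) (x : X) :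
    Tendsto (fun n => F n x) atTop (𝓝 (S x)) := by
  have hM0 : 0 ≤ M := (norm_nonneg _).trans (hM 0)
  rw [Metric.tendsto_atTop]
  intro ε hε
  obtain ⟨v, hv⟩ := hj.exists_dist_lt x (show 0 < ε / (3 * (M + ‖S‖ + 1)) by positivity)
  obtain ⟨N, hN⟩ := Metric.tendsto_atTop.1 (hF v) (ε / 3) (by positivity)
  have hb : ∀ G : X →L[ℂ] X, ‖G‖ ≤ M + ‖S‖ + 1 → dist (G x) (G (j v)) ≤ ε / 3 := by
    intro G hG
    rw [dist_eq_norm, ← map_sub]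
    refine (G.le_of_opNorm_le hG _).trans ?_
    rw [← dist_eq_norm]
    calc _ ≤ (M + ‖S‖ + 1) * (ε / (3 * (M + ‖S‖ + 1))) := by gcongr
      _ = ε / 3 := by field_simp
  refine ⟨N, fun n hn => ?_⟩
  have h1 := hb (F n) (by linarith [hM n, norm_nonneg S])
  have h2 := hb S (by linarith)
  have h3 := hN n hn
  have h4 := dist_triangle4 (F n x) (F n (j v)) (S (j v)) (S x)
  rw [dist_comm (S (j v))] at h4
  linarith

section Product

variable {X₀ X₁ X₂ : Type*}
  [NormedAddCommGroup X₀] [NormedSpace ℂ X₀]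
  [NormedAddCommGroup X₁] [NormedSpace ℂ X₁]
  [NormedAddCommGroup X₂] [NormedSpace ℂ X₂]
  {ι₁ : X₁ →L[ℂ] X₀} {ι₂ : X₂ →L[ℂ] X₁}

variable {E EA EB : EulerScheme ι₁ ι₂}
  {S₀ A₀ B₀ : ℝ → ℝ → X₀ →L[ℂ] X₀} {S₁ A₁ B₁ : ℝ → ℝ → X₁ →L[ℂ] X₁}
  {S₂ A₂ B₂ : ℝ → ℝ → X₂ →L[ℂ] X₂} {M K MA KA MB KB : ℝ}

/-- Consistency of the splitting along a trajectory of the sum, locally uniformly in time. -/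
theorem EulerScheme.IsPropagator.exists_norm_splitting_sub_le
    (P : E.IsPropagator S₀ S₁ S₂ M K) (PA : EA.IsPropagator A₀ A₁ A₂ MA KA)
    (PB : EB.IsPropagator B₀ B₁ B₂ MB KB) (hd₁ : DenseRange ι₁) (hd₂ : DenseRange ι₂)
    {s t r : ℝ} (hs : 0 ≤ s) (hr : r ∈ Icc s t)
    (hgen : ∀ x, E.gen r x = EA.gen r x + EB.gen r x) (x : X₁) {ε : ℝ} (hε : 0 < ε) :
    ∃ δ > 0, ∀ u v, |u - r| < δ → |v - r| < δ → s ≤ u → u ≤ v → v ≤ t →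
      ‖A₀ v u (B₀ v u (S₀ u s (ι₁ x))) - S₀ v u (S₀ u s (ι₁ x))‖ ≤ ε * (v - u) := by
  set Λ := Real.exp (EA.rate * t)
  have hΛ : 0 < Λ := Real.exp_pos _
  set a := EA.gen r (S₁ r s x)
  set b := EB.gen r (S₁ r s x)
  have hbd : ∀ u ∈ Icc s t, ‖S₁ u s x‖ ≤ M * Real.exp (E.rate * t) * ‖x‖ := fun u hu =>
    ContinuousLinearMap.le_of_opNorm_le _ ((P.norm₁_le s u hs hu.1).trans
      (mul_le_mul_of_nonneg_left (E.exp_le hs hu.2) P.M_pos.le)) x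
  obtain ⟨δ₁, hδ₁, H₁⟩ := PA.exists_norm_sub_le hd₁ hbd
    (P.continuousOn_gen hd₁ hd₂ EA r hs t x r hr) (show 0 < ε / 4 by positivity)
  obtain ⟨δ₂, hδ₂, H₂⟩ := PB.exists_norm_sub_le hd₁ hbd
    (P.continuousOn_gen hd₁ hd₂ EB r hs t x r hr) (show 0 < ε / (4 * Λ) by positivity)
  obtain ⟨δ₃, hδ₃, H₃⟩ := P.exists_norm_sub_le hd₁ hbd
    (P.continuousOn_gen hd₁ hd₂ E r hs t x r hr) (show 0 < ε / 4 by positivity)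
  have hr0 : 0 ≤ r := hs.trans hr.1
  obtain ⟨δ₄, hδ₄, H₄⟩ := Metric.continuousOn_iff.1 (PA.continuousOn_simplex2 hd₁ t b) (r, r)
    ⟨hr0, le_rfl, hr.2⟩ (ε / 4) (by positivity)
  refine ⟨min (min δ₁ δ₂) (min δ₃ δ₄), by positivity, fun u v hu hv hsu huv hvt => ?_⟩
  simp only [lt_min_iff] at hu hv
  have hu0 : 0 ≤ u := hs.trans hsu
  have huI : u ∈ Icc s t := ⟨hsu, huv.trans hvt⟩
  have h1 := H₁ u v huI hu.1.1 hv.1.1 hu0 huv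
  have h2 := H₂ u v huI hu.1.2 hv.1.2 hu0 huv
  have h3 := H₃ u v huI hu.2.1 hv.2.1 hu0 huv
  have h4 := H₄ (v, u) ⟨hu0, huv, hvt⟩ (by
    rw [Prod.dist_eq, max_lt_iff, Real.dist_eq, Real.dist_eq]; exact ⟨hv.2.2, hu.2.2⟩)
  rw [PA.self r hr0, dist_eq_norm] at h4
  rw [P.map₁ s u x hs hsu] at h1 h2 h3
  beta_reduce at h1 h2 h3
  rw [hgen] at h3
  set z := S₀ u s (ι₁ x)
  have hvu : 0 ≤ v - u := sub_nonneg.2 huv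
  have hsplit : A₀ v u (B₀ v u z) - S₀ v u z =
      A₀ v u (B₀ v u z - z - (v - u) • b) + (v - u) • (A₀ v u b - b) +
      (A₀ v u z - z - (v - u) • a) - (S₀ v u z - z - (v - u) • (a + b)) := by
    rw [map_sub, map_sub, ContinuousLinearMap.map_smul_of_tower, smul_sub, smul_add]
    abel
  have h5 : ‖A₀ v u (B₀ v u z - z - (v - u) • b)‖ ≤ ε / 4 * (v - u) := by
    refine (ContinuousLinearMap.le_of_opNorm_le _
      ((PA.norm₀_le u v hu0 huv).trans (EA.exp_le hu0 hvt)) _).trans ?_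
    calc Λ * _ ≤ Λ * (ε / (4 * Λ) * (v - u)) := by gcongr
      _ = _ := by field_simp
  have h6 : ‖(v - u) • (A₀ v u b - b)‖ ≤ ε / 4 * (v - u) := by
    rw [norm_smul, Real.norm_of_nonneg hvu, mul_comm]
    gcongr
    exact h4.le
  rw [hsplit]
  refine (norm_sub_le _ _).trans ((add_le_add norm_add₃_le h3).trans ?_)
  linarith

/-- Convergence of the splitting along a trajectory of the sum. -/
theorem EulerScheme.IsPropagator.tendsto_orderedProd
    (P : E.IsPropagator S₀ S₁ S₂ M K) (PA : EA.IsPropagator A₀ A₁ A₂ MA KA)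
    (PB : EB.IsPropagator B₀ B₁ B₂ MB KB) (hd₁ : DenseRange ι₁) (hd₂ : DenseRange ι₂)
    {s t : ℝ} (hs : 0 ≤ s) (hst : s ≤ t)
    (hgen : ∀ r ∈ Icc s t, ∀ x, E.gen r x = EA.gen r x + EB.gen r x)
    (Q : ℕ → IntervalPartition s t) (hQ : Tendsto (fun n => (Q n).mesh) atTop (𝓝 0)) (x : X₀) :
    Tendsto (fun n => orderedProd (fun v u => A₀ v u ∘L B₀ v u) (Q n).node (Q n).size x)
      atTop (𝓝 (S₀ t s x)) := by
  set c := EA.rate + EB.rate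
  have hc : 0 < c := add_pos EA.rate_pos EB.rate_pos
  have hnorm : ∀ n, ∀ i < (Q n).size,
      ‖A₀ ((Q n).node (i + 1)) ((Q n).node i) ∘L B₀ ((Q n).node (i + 1)) ((Q n).node i)‖ ≤
        Real.exp (c * ((Q n).node (i + 1) - (Q n).node i)) := by
    intro n i hi
    have h0 : 0 ≤ (Q n).node i := hs.trans ((Q n).le_node hi.le)
    have h1 := ((Q n).node_lt i hi).le
    refine (ContinuousLinearMap.opNorm_comp_le _ _).trans ?_
    rw [add_mul, Real.exp_add]
    exact mul_le_mul (PA.norm₀_le _ _ h0 h1) (PB.norm₀_le _ _ h0 h1) (norm_nonneg _)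
      (Real.exp_pos _).le
  have hsum : ∀ n (e : ℝ), ∑ i ∈ Finset.range (Q n).size,
      e * ((Q n).node (i + 1) - (Q n).node i) = e * (t - s) := fun n e => by
    rw [← Finset.mul_sum, (Q n).sum_sub]
  refine tendsto_clm_of_denseRange hd₁ (M := Real.exp (c * (t - s))) (fun n => ?_) (fun y => ?_) x
  · rw [orderedProd_eq_stepProd, ← hsum n c]
    exact norm_stepProd_le_exp_sum fun i hi => by simpa only [zero_add] using hnorm n i hi
  rw [Metric.tendsto_atTop]
  intro ε hε
  set ε₁ := ε / (2 * (Real.exp (c * (t - s)) * (t - s + 1)))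
  have hts : 0 ≤ t - s := sub_nonneg.2 hst
  have hε₁ : 0 < ε₁ := by positivity
  have hloc : ∀ r : Icc s t, ∃ δ > (0 : ℝ), ∀ u v : ℝ, |u - r| < δ → |v - r| < δ →
      s ≤ u → u ≤ v → v ≤ t →
      ‖A₀ v u (B₀ v u (S₀ u s (ι₁ y))) - S₀ v u (S₀ u s (ι₁ y))‖ ≤ ε₁ * (v - u) := fun r =>
    P.exists_norm_splitting_sub_le PA PB hd₁ hd₂ hs r.2 (hgen r r.2) y hε₁
  choose d hd hloc using hloc
  obtain ⟨δ, hδ, hleb⟩ := lebesgue_number_lemma_of_metric (isCompact_Icc (a := s) (b := t))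
    (c := fun r : Icc s t => Metric.ball (r : ℝ) (d r)) (fun _ => Metric.isOpen_ball)
    (fun r hr => mem_iUnion.2 ⟨⟨r, hr⟩, Metric.mem_ball_self (hd _)⟩)
  obtain ⟨N, hN⟩ := Metric.tendsto_atTop.1 hQ δ hδ
  refine ⟨N, fun n hn => ?_⟩
  have hmesh : (Q n).mesh < δ := by
    have := hN n hn
    rw [Real.dist_eq, sub_zero] at this
    exact (le_abs_self _).trans_lt this
  set τ := (Q n).node
  have htraj : ∀ i ≤ (Q n).size,
      stepProd (fun i => S₀ (τ (i + 1)) (τ i)) 0 i (ι₁ y) = S₀ (τ i) s (ι₁ y) := by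
    intro i
    induction i with
    | zero =>
      intro _
      have : τ 0 = s := (Q n).node_zero
      rw [this, P.self s hs]
      rfl
    | succ i ih =>
      intro hi
      rw [stepProd_succ_apply, ih (by omega), zero_add]
      exact (P.trans_apply hs ((Q n).le_node (by omega)) ((Q n).node_lt i (by omega)).le _).symm
  have h1 := norm_stepProd_sub_le (F := fun i => A₀ (τ (i + 1)) (τ i) ∘L B₀ (τ (i + 1)) (τ i))
    (G := fun i => S₀ (τ (i + 1)) (τ i)) (a := fun i => c * (τ (i + 1) - τ i))
    (e := fun i => ε₁ * (τ (i + 1) - τ i)) (k := 0) (n := (Q n).size) (x := ι₁ y)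
    (fun i hi => mul_nonneg hc.le (sub_nonneg.2 ((Q n).node_lt i hi).le))
    (fun i hi => by simpa only [zero_add] using hnorm n i hi)
    (fun i hi => by
      rw [htraj i hi.le, zero_add]
      have hle := ((Q n).node_lt i hi).le
      have hmem : τ i ∈ Icc s t := ⟨(Q n).le_node hi.le, (Q n).node_le hi.le⟩
      obtain ⟨r, hr⟩ := hleb (τ i) hmem
      have hm := ((Q n).sub_le_mesh hi).trans_lt hmesh
      have hu := hr (Metric.mem_ball_self hδ)
      have hv : τ (i + 1) ∈ Metric.ball (r : ℝ) (d r) := hr (by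
        rw [Metric.mem_ball, Real.dist_eq, abs_of_nonneg (sub_nonneg.2 hle)]
        exact hm)
      rw [Metric.mem_ball, Real.dist_eq] at hu hv
      exact hloc r _ _ hu hv hmem.1 hle ((Q n).node_le hi))
  have hend : τ (Q n).size = t := (Q n).node_size
  rw [htraj _ le_rfl, hend, hsum, hsum] at h1
  rw [orderedProd_eq_stepProd, dist_eq_norm]
  refine h1.trans_lt ?_
  have h2 : Real.exp (c * (t - s)) * (ε₁ * (t - s)) ≤
      Real.exp (c * (t - s)) * (ε₁ * (t - s + 1)) := by gcongr; linarith
  have h3 : Real.exp (c * (t - s)) * (ε₁ * (t - s + 1)) = ε / 2 := by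
    simp only [ε₁]
    field_simp
  linarith

end Product

theorem orderedProd_congr {X : Type*} [NormedAddCommGroup X] [NormedSpace ℂ X]
    {μ ν : ℝ → ℝ → X →L[ℂ] X} {τ : ℕ → ℝ} {n : ℕ}
    (h : ∀ i < n, μ (τ (i + 1)) (τ i) = ν (τ (i + 1)) (τ i)) :
    orderedProd μ τ n = orderedProd ν τ n := by
  induction n with
  | zero => rfl
  | succ n ih => rw [orderedProd, orderedProd, h n (by omega), ih fun i hi => h i (by omega)]

end

theorem theorem3p9 {X₀ X₁ X₂ : Type*}
    [NormedAddCommGroup X₀] [NormedSpace ℂ X₀] [CompleteSpace X₀]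
    [NormedAddCommGroup X₁] [NormedSpace ℂ X₁] [CompleteSpace X₁]
    [NormedAddCommGroup X₂] [NormedSpace ℂ X₂] [CompleteSpace X₂]
    (hX₀ : IsReflexiveSpace X₀) (hX₁ : IsReflexiveSpace X₁) (hX₂ : IsReflexiveSpace X₂)
    (ι₁ : X₁ →L[ℂ] X₀) (hι₁ : Function.Injective ι₁) (hd₁ : DenseRange ι₁)
    (ι₂ : X₂ →L[ℂ] X₁) (hι₂ : Function.Injective ι₂) (hd₂ : DenseRange ι₂)
    (T : ℝ) (hT : 0 < T) (A B : ℝ → X₀ →ₗ.[ℂ] X₀)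
    (hA : IsAdmissibleFamily T ι₁ ι₂ A) (hB : IsAdmissibleFamily T ι₁ ι₂ B)
    (hclos : ∀ t ∈ Icc 0 T, (A t + B t).IsClosable)
    (hAB : IsAdmissibleFamily T ι₁ ι₂ (fun t => (A t + B t).closure)) :
    (∃ SA, IsQuasipropagator T ι₁ A SA) ∧
    (∃ SB, IsQuasipropagator T ι₁ B SB) ∧
    (∃ SAB, IsQuasipropagator T ι₁ (fun t => (A t + B t).closure) SAB) ∧
    ∀ SA SB SAB : ℝ → ℝ → X₀ →L[ℂ] X₀,
      IsQuasipropagator T ι₁ A SA → IsQuasipropagator T ι₁ B SB →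
      IsQuasipropagator T ι₁ (fun t => (A t + B t).closure) SAB →
      ∀ s t, 0 ≤ s → s ≤ t → t ≤ T →
      ∀ P : ℕ → IntervalPartition s t,
        Tendsto (fun n => (P n).mesh) atTop (𝓝 0) →
        ∀ x : X₀,
          Tendsto (fun n => orderedProd (fun v u => SA v u ∘L SB v u) (P n).node (P n).size x)
            atTop (𝓝 (SAB t s x)) := by
  obtain ⟨EA, hEA⟩ := hA.exists_eulerScheme hT.le hι₁ hι₂
  obtain ⟨EB, hEB⟩ := hB.exists_eulerScheme hT.le hι₁ hι₂
  obtain ⟨E, hE⟩ := hAB.exists_eulerScheme hT.le hι₁ hι₂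
  obtain ⟨A₀, A₁, A₂, MA, KA, PA⟩ := EA.exists_isPropagator hX₁ hX₂ hι₁ hd₁ hι₂ hd₂
  obtain ⟨B₀, B₁, B₂, MB, KB, PB⟩ := EB.exists_isPropagator hX₁ hX₂ hι₁ hd₁ hι₂ hd₂
  obtain ⟨S₀, S₁, S₂, M, K, PS⟩ := E.exists_isPropagator hX₁ hX₂ hι₁ hd₁ hι₂ hd₂
  have qA := PA.isQuasipropagator hd₁ hd₂ fun t ht x => ⟨_, (hEA t ht x).symm⟩
  have qB := PB.isQuasipropagator hd₁ hd₂ fun t ht x => ⟨_, (hEB t ht x).symm⟩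
  have qS := PS.isQuasipropagator hd₁ hd₂ (L := fun t => (A t + B t).closure)
    fun t ht x => ⟨_, (hE t ht x).symm⟩
  refine ⟨⟨_, qA⟩, ⟨_, qB⟩, ⟨_, qS⟩, fun SA SB SAB hSA hSB hSAB s t hs hst htT Q hQ x => ?_⟩
  have hgen : ∀ r ∈ Icc s t, ∀ y, E.gen r y = EA.gen r y + EB.gen r y := by
    intro r hr y
    have hr' : r ∈ Icc 0 T := ⟨hs.trans hr.1, hr.2.trans htT⟩
    rw [hE r hr', hEA r hr', hEB r hr']
    have h1 := (LinearPMap.le_closure (A r + B r)).2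
      (x := ⟨ι₁ y, hA.dom₁ r hr' y, hB.dom₁ r hr' y⟩) (y := ⟨ι₁ y, hAB.dom₁ r hr' y⟩) rfl
    rw [← h1, LinearPMap.add_apply]
  rw [hSAB.eq qS hd₁ hs hst htT]
  refine (PS.tendsto_orderedProd PA PB hd₁ hd₂ hs hst hgen Q hQ x).congr fun n => ?_
  -- by uniqueness the given quasipropagators obey the bounds with constant one
  rw [orderedProd_congr]
  intro i hi
  have h0 : 0 ≤ (Q n).node i := hs.trans ((Q n).le_node hi.le)
  have h1 := ((Q n).node_lt i hi).le
  have h2 : (Q n).node (i + 1) ≤ T := ((Q n).node_le hi).trans htT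
  rw [hSA.eq qA hd₁ h0 h1 h2, hSB.eq qB hd₁ h0 h1 h2]
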